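/- Let $\mathcal H$ be a finite-dimensional complex Hilbert space, $\mathcal L_h$ the real space of Hermitian operators on $\mathcal H$, and $\mathcal S=\mathcal S(\mathcal H)$ the manifold of strictly positive density operators, an open subset of the affine space $\{A\in\mathcal L_h : \operatorname{Tr}A=1\}$; identify each tangent space $T_\rho(\mathcal S)$ with $\{A\in\mathcal L_h:\operatorname{Tr}A=0\}$. The SLD structure on $\mathcal S$ consists of the following. The symmetric logarithmic derivative of $X_\rho\in T_\rho(\mathcal S)$ is the Hermitian operator $L_{X_\rho}$ with $X_\rho=\frac12(\rho L_{X_\rho}+L_{X_\rho}\rho)$. The SLD metric is $g_\rho(X_\rho,Y_\rho)=\operatorname{Re}\operatorname{Tr}(\rho L_{X_\rho}L_{Y_\rho})$. The m-connection $\nabla^{(m)}$ is the flat connection of the affine structure, so that $\nabla^{(m)}_XY$ is the ordinary derivative of $Y$ along $X$. The e-connection $\nabla^{(e)}$ is its dual, determined by $X\,g(Y,Z)=g(\nabla^{(e)}_XY,Z)+g(Y,\nabla^{(m)}_XZ)$ for all smooth vector fields $X,Y,Z$ on $\mathcal S$. Let $\mathcal M$ be a (nonempty) connected $n$-dimensional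 submanifold of $\mathcal S$, i.e. the image of a smooth injective immersion of a connected smooth $n$-manifold. It is called e-autoparallel in $\mathcal S$ if $\nabla^{(e)}_XY$ is again a smooth vector field on $\mathcal M$ (tangent to $\mathcal M$) for all smooth vector fields $X,Y$ on $\mathcal M$. An estimator is a positive operator-valued measure $\Lambda$ on the Borel sets of $\mathbb R$, acting on $\mathcal H$. Put $E_\rho(\Lambda)=\int t\,\operatorname{Tr}(\rho\Lambda(dt))$ and, for a smooth function $f:\mathcal M\to\mathbb R$ and $\rho\in\mathcal M$, $V_\rho(\Lambda)=\int (t-f(\rho))^2\,\operatorname{Tr}(\rho\Lambda(dt))$. The estimator $\Lambda$ is locally efficient for $f$ at $\rho\in\mathcal M$ if it is locally unbiased, i.e. the integral $E_\rho(\Lambda)$ exists, $E_\rho(\Lambda)=f(\rho)$ and $(dE(\Lambda))_\rho=(df)_\rho$ on $T_\rho(\mathcal M)$, and if $V_\rho(\Lambda)=\|(df)_\rho\|_\rho^2$, where $\|\cdot\|_\rho$ is the norm on $T^*_\rho(\mathcal M)$ dual to $g_\rho|_{T_\rho(\mathcal M)}$. It is efficient for $f$ if it is locally efficient for $f$ at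 every $\rho\in\mathcal M$. Let $\mathcal E(\mathcal M)$ be the set of smooth real functions $f$ on $\mathcal M$ for which there exists an efficient estimator. Theorem. $\mathcal E(\mathcal M)$ is a linear subspace of the space of smooth functions on $\mathcal M$, and the following conditions are equivalent: (i) $\mathcal M$ is e-autoparallel in $\mathcal S$; (ii) $\dim\mathcal E(\mathcal M)=n+1$. -/

import Mathlib

open scoped Manifold ContDiff

noncomputable section

namespace QuantumInfoGeom

/-- The (finite-dimensional) algebra of linear operators on `H`. -/
abbrev Op (H : Type*) [NormedAddCommGroup H] [InnerProductSpace ℂ H] := H →L[ℂ] H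

section Operators

variable {H : Type*} [NormedAddCommGroup H] [InnerProductSpace ℂ H] [FiniteDimensional ℂ H]

/-- The trace of an operator. -/
def tr : Op H →L[ℂ] ℂ :=
  LinearMap.toContinuousLinearMap (LinearMap.trace ℂ H ∘ₗ ContinuousLinearMap.coeLM ℂ)

/-- The real part of the trace; on Hermitian operators it is the trace. -/
def reTr : Op H →L[ℝ] ℝ := Complex.reCLM.comp (tr.restrictScalars ℝ)

variable (H) in
/-- The set `𝒮(H)` of strictly positive density operators. -/
def StateSpace : Set (Op H) :=
  {ρ | IsSelfAdjoint ρ ∧ (∀ x : H, x ≠ 0 → 0 < (inner ℂ x (ρ x)).re) ∧ tr ρ = 1}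

variable (H) in
/-- The traceless Hermitian operators: the tangent space of `𝒮(H)` at each of its points,
tangent vectors being identified with their images in the space of operators. -/
def TangentOps : Submodule ℝ (Op H) where
  carrier := {A | IsSelfAdjoint A ∧ tr A = 0}
  add_mem' {A B} hA hB := ⟨hA.1.add hB.1, by rw [map_add tr A B, hA.2, hB.2, add_zero]⟩
  zero_mem' := ⟨IsSelfAdjoint.zero _, map_zero tr⟩
  smul_mem' c A hA := ⟨by
    have h := hA.1
    rw [IsSelfAdjoint] at h ⊢
    rw [star_smul, star_trivial, h], by
    rw [← Complex.coe_smul, map_smul tr, hA.2, smul_zero]⟩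

/-- The symmetrized product `A ∘ B = (A B + B A) / 2`, as a bilinear map. -/
def jordan : Op H →L[ℝ] Op H →L[ℝ] Op H :=
  (1 / 2 : ℝ) • (ContinuousLinearMap.mul ℝ (Op H) + (ContinuousLinearMap.mul ℝ (Op H)).flip)

/-- The symmetrized inner product `⟪A, B⟫_ρ = Re Tr (ρ A B)`. -/
def symInner (ρ A B : Op H) : ℝ := reTr (ρ * A * B)

/-- The symmetric logarithmic derivative `L` of the tangent vector `A` at `ρ`:
the solution of `ρ ∘ L = A` (see `jordan_sld`, `reTr_mul_eq_symInner` and `sld_unique`). -/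
def sld (ρ A : Op H) : Op H := Ring.inverse (jordan ρ) A

/-- The SLD metric `g_ρ(A, B) = ⟪L_A, L_B⟫_ρ` on tangent vectors. -/
def sldMetric (ρ A B : Op H) : ℝ := symInner ρ (sld ρ A) (sld ρ B)

/-- Smooth vector fields on `𝒮(H)`. -/
def IsVectorField (X : Op H → Op H) : Prop :=
  ContDiffOn ℝ ∞ X (StateSpace H) ∧ ∀ ρ ∈ StateSpace H, X ρ ∈ TangentOps H

/-- The m-connection: `∇⁽ᵐ⁾_X Y` is the derivative of `Y` along `X`
(a point of `𝒮(H)` stays in `𝒮(H)` when it moves a little in a tangent direction, so the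
derivative along the line depends only on the values of `Y` on `𝒮(H)`). -/
def mConn (X Y : Op H → Op H) (ρ : Op H) : Op H := lineDeriv ℝ Y ρ (X ρ)

/-- `W` is a tangent vector at `ρ` that satisfies, for all vector fields `Z`, the relation
`X g(Y, Z) = g(W, Z) + g(Y, ∇⁽ᵐ⁾_X Z)` at `ρ`. -/
def IsDualValue (X Y : Op H → Op H) (ρ W : Op H) : Prop :=
  W ∈ TangentOps H ∧ ∀ Z : Op H → Op H, IsVectorField Z →
    lineDeriv ℝ (fun σ => sldMetric σ (Y σ) (Z σ)) ρ (X ρ) =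
      sldMetric ρ W (Z ρ) + sldMetric ρ (Y ρ) (mConn X Z ρ)

/-- The e-connection of the SLD structure: the dual of the m-connection with respect to the SLD
metric (see `isDualValue_iff` for existence and uniqueness). -/
def eConn (X Y : Op H → Op H) (ρ : Op H) : Op H := Classical.epsilon (IsDualValue X Y ρ)

/-- The Christoffel symbol of the e-connection in the affine coordinates of `𝒮(H)`: the
e-covariant derivative of a constant vector field in a constant direction. -/
def eChristoffel (ρ A B : Op H) : Op H := eConn (fun _ => A) (fun _ => B) ρ

end Operators

section Facts

variable {H : Type*} [NormedAddCommGroup H] [InnerProductSpace ℂ H] [FiniteDimensional ℂ H]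

theorem tr_eq_sum {ι : Type*} [Fintype ι] (b : OrthonormalBasis ι ℂ H) (A : Op H) :
    tr A = ∑ i, inner ℂ (b i) (A (b i)) :=
  LinearMap.trace_eq_sum_inner (A : H →ₗ[ℂ] H) b

theorem tr_mul_comm (A B : Op H) : tr (A * B) = tr (B * A) :=
  LinearMap.trace_mul_comm ℂ (A : H →ₗ[ℂ] H) (B : H →ₗ[ℂ] H)

theorem tr_star (A : Op H) : tr (star A) = star (tr A) := by
  rw [tr_eq_sum (stdOrthonormalBasis ℂ H), tr_eq_sum (stdOrthonormalBasis ℂ H), star_sum]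
  refine Finset.sum_congr rfl fun i _ => ?_
  rw [ContinuousLinearMap.star_eq_adjoint, ContinuousLinearMap.adjoint_inner_right]
  exact (inner_conj_symm _ _).symm

theorem reTr_apply (A : Op H) : reTr A = (tr A).re := rfl

theorem reTr_mul_comm (A B : Op H) : reTr (A * B) = reTr (B * A) := by
  rw [reTr_apply, tr_mul_comm, reTr_apply]

theorem reTr_star (A : Op H) : reTr (star A) = reTr A := by
  rw [reTr_apply, tr_star, reTr_apply]; simp

theorem tr_eq_reTr {A : Op H} (hA : IsSelfAdjoint A) : tr A = (reTr A : ℂ) := by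
  have h := tr_star A
  rw [hA.star_eq] at h
  exact (Complex.conj_eq_iff_real.1 h.symm).elim fun r hr => by rw [reTr_apply, hr]; simp

theorem reTr_eq_sum {ι : Type*} [Fintype ι] (b : OrthonormalBasis ι ℂ H) (A : Op H) :
    reTr A = ∑ i, (inner ℂ (b i) (A (b i))).re := by
  rw [reTr_apply, tr_eq_sum b, Complex.re_sum]

theorem inner_nonneg_of_mem {ρ : Op H} (hρ : ρ ∈ StateSpace H) (x : H) :
    0 ≤ (inner ℂ x (ρ x)).re := by
  by_cases hx : x = 0
  · simp [hx]
  · exact (hρ.2.1 x hx).le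

theorem reTr_star_mul_mul_nonneg {ρ : Op H} (hρ : ρ ∈ StateSpace H) (B : Op H) :
    0 ≤ reTr (star B * (ρ * B)) := by
  rw [reTr_eq_sum (stdOrthonormalBasis ℂ H)]
  refine Finset.sum_nonneg fun i _ => ?_
  rw [mul_apply_eq_comp, ContinuousLinearMap.star_eq_adjoint,
    ContinuousLinearMap.adjoint_inner_right]
  exact inner_nonneg_of_mem hρ _

theorem eq_zero_of_reTr {ρ : Op H} (hρ : ρ ∈ StateSpace H) (B : Op H)
    (h : reTr (star B * (ρ * B)) ≤ 0) : B = 0 := by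
  have h0 := le_antisymm h (reTr_star_mul_mul_nonneg hρ B)
  rw [reTr_eq_sum (stdOrthonormalBasis ℂ H)] at h0
  have key : ∀ i, (inner ℂ ((stdOrthonormalBasis ℂ H) i)
      ((star B * (ρ * B)) ((stdOrthonormalBasis ℂ H) i))).re
      = (inner ℂ (B ((stdOrthonormalBasis ℂ H) i))
        (ρ (B ((stdOrthonormalBasis ℂ H) i)))).re := by
    intro i
    rw [mul_apply_eq_comp, ContinuousLinearMap.star_eq_adjoint,
      ContinuousLinearMap.adjoint_inner_right]
    rfl
  rw [Finset.sum_congr rfl fun i _ => key i,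
    Finset.sum_eq_zero_iff_of_nonneg fun i _ => inner_nonneg_of_mem hρ _] at h0
  have h1 : ∀ i, B ((stdOrthonormalBasis ℂ H) i) = 0 := by
    intro i
    by_contra hne
    exact (hρ.2.1 _ hne).ne' (h0 i (Finset.mem_univ i))
  have h2 : (B : H →ₗ[ℂ] H) = 0 :=
    (stdOrthonormalBasis ℂ H).toBasis.ext fun i => by simpa using h1 i
  ext x
  exact LinearMap.congr_fun h2 x

theorem jordan_apply (A B : Op H) : jordan A B = (1 / 2 : ℝ) • (A * B + B * A) := rfl

theorem jordan_comm (A B : Op H) : jordan A B = jordan B A := by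
  rw [jordan_apply, jordan_apply, add_comm]

theorem isSelfAdjoint_jordan {A B : Op H} (hA : IsSelfAdjoint A) (hB : IsSelfAdjoint B) :
    IsSelfAdjoint (jordan A B) := by
  rw [IsSelfAdjoint, jordan_apply, star_smul, star_add, star_mul, star_mul, hA.star_eq,
    hB.star_eq, star_trivial, add_comm]

theorem reTr_jordan (A B : Op H) : reTr (jordan A B) = reTr (A * B) := by
  rw [jordan_apply, map_smul, map_add, reTr_mul_comm B A, smul_eq_mul]; ring

/-- `Tr ((A ∘ B) C) = Tr (B (A ∘ C))`. -/
theorem reTr_jordan_mul (A B C : Op H) : reTr (jordan A B * C) = reTr (B * jordan A C) := by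
  rw [jordan_apply, jordan_apply, smul_mul_assoc, mul_smul_comm, map_smul, map_smul, add_mul,
    mul_add, map_add, map_add, mul_assoc A B C, reTr_mul_comm A (B * C), mul_assoc B A C,
    mul_assoc B C A, add_comm]

theorem isUnit_jordan {ρ : Op H} (hρ : ρ ∈ StateSpace H) : IsUnit (jordan ρ) := by
  rw [ContinuousLinearMap.isUnit_iff_bijective]
  have hinj : Function.Injective (jordan ρ : Op H →ₗ[ℝ] Op H) := by
    rw [← LinearMap.ker_eq_bot, LinearMap.ker_eq_bot']
    intro B hB
    have hB' : jordan ρ B = 0 := hB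
    have h1 : reTr (star B * jordan ρ B) = 0 := by rw [hB', mul_zero, map_zero]
    have h2 : reTr (star B * jordan ρ B) =
        (1 / 2) * (reTr (star B * (ρ * B)) + reTr (star (star B) * (ρ * star B))) := by
      rw [jordan_apply, mul_smul_comm, map_smul, mul_add, map_add, star_star,
        reTr_mul_comm (star B) (B * ρ), mul_assoc B ρ, smul_eq_mul]
    have h3 := reTr_star_mul_mul_nonneg hρ (star B)
    exact eq_zero_of_reTr hρ B (by linarith)
  exact ⟨hinj, LinearMap.injective_iff_surjective.1 hinj⟩

theorem jordan_sld {ρ : Op H} (hρ : ρ ∈ StateSpace H) (A : Op H) : jordan ρ (sld ρ A) = A := by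
  have h := Ring.mul_inverse_cancel _ (isUnit_jordan hρ)
  exact congrArg (fun T : Op H →L[ℝ] Op H => T A) h

theorem sld_jordan {ρ : Op H} (hρ : ρ ∈ StateSpace H) (A : Op H) : sld ρ (jordan ρ A) = A := by
  have h := Ring.inverse_mul_cancel _ (isUnit_jordan hρ)
  exact congrArg (fun T : Op H →L[ℝ] Op H => T A) h

theorem isSelfAdjoint_sld {ρ A : Op H} (hρ : ρ ∈ StateSpace H) (hA : IsSelfAdjoint A) :
    IsSelfAdjoint (sld ρ A) := by
  have h : jordan ρ (star (sld ρ A)) = A := by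
    conv_rhs => rw [← hA.star_eq, ← jordan_sld hρ A]
    rw [jordan_apply, jordan_apply, star_smul, star_add, star_mul, star_mul, hρ.1.star_eq,
      star_trivial (1 / 2 : ℝ), add_comm]
  rw [IsSelfAdjoint]
  conv_rhs => rw [← h]
  rw [sld_jordan hρ]

theorem symInner_eq {ρ A B : Op H} (hρ : ρ ∈ StateSpace H) (hA : IsSelfAdjoint A)
    (hB : IsSelfAdjoint B) : symInner ρ A B = reTr (jordan ρ A * B) := by
  have h : reTr (A * ρ * B) = reTr (ρ * A * B) := by
    rw [← reTr_star (A * ρ * B), star_mul, star_mul, hA.star_eq, hB.star_eq, hρ.1.star_eq,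
      reTr_mul_comm]
  rw [symInner, jordan_apply, smul_mul_assoc, map_smul, add_mul, map_add, h, smul_eq_mul]
  ring

/-- The defining relation of the symmetric logarithmic derivative: the derivative `Tr (A B)` of
`σ ↦ Tr (σ B)` along `A` is `⟪L, B⟫_ρ` for every Hermitian `B`. -/
theorem reTr_mul_eq_symInner {ρ A B : Op H} (hρ : ρ ∈ StateSpace H) (hA : IsSelfAdjoint A)
    (hB : IsSelfAdjoint B) : reTr (A * B) = symInner ρ (sld ρ A) B := by
  rw [symInner_eq hρ (isSelfAdjoint_sld hρ hA) hB, jordan_sld hρ]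

theorem eq_zero_of_forall_reTr {A : Op H} (hA : IsSelfAdjoint A)
    (h : ∀ B : Op H, IsSelfAdjoint B → reTr (A * B) = 0) : A = 0 := by
  have h0 := h A hA
  rw [reTr_eq_sum (stdOrthonormalBasis ℂ H)] at h0
  have key : ∀ i, (inner ℂ ((stdOrthonormalBasis ℂ H) i)
      ((A * A) ((stdOrthonormalBasis ℂ H) i))).re = ‖A ((stdOrthonormalBasis ℂ H) i)‖ ^ 2 := by
    intro i
    conv_lhs => rw [← hA.star_eq]
    rw [hA.star_eq, mul_apply_eq_comp]
    nth_rewrite 1 [← hA.star_eq]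
    rw [ContinuousLinearMap.star_eq_adjoint, ContinuousLinearMap.adjoint_inner_right]
    exact inner_self_eq_norm_sq (𝕜 := ℂ) _
  rw [Finset.sum_congr rfl fun i _ => key i,
    Finset.sum_eq_zero_iff_of_nonneg fun i _ => by positivity] at h0
  have h2 : (A : H →ₗ[ℂ] H) = 0 :=
    (stdOrthonormalBasis ℂ H).toBasis.ext fun i => by
      simpa using h0 i (Finset.mem_univ i)
  ext x
  exact LinearMap.congr_fun h2 x

theorem sld_unique {ρ A L : Op H} (hρ : ρ ∈ StateSpace H) (hA : IsSelfAdjoint A)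
    (hL : IsSelfAdjoint L) (h : ∀ B : Op H, IsSelfAdjoint B → reTr (A * B) = symInner ρ L B) :
    L = sld ρ A := by
  have h1 : A - jordan ρ L = 0 := by
    refine eq_zero_of_forall_reTr (hA.sub (isSelfAdjoint_jordan hρ.1 hL)) fun B hB => ?_
    rw [sub_mul, map_sub, h B hB, symInner_eq hρ hL hB, sub_self]
  rw [sub_eq_zero.1 h1, sld_jordan hρ]

theorem sldMetric_eq {ρ A B : Op H} (hρ : ρ ∈ StateSpace H) (hA : IsSelfAdjoint A)
    (hB : IsSelfAdjoint B) : sldMetric ρ A B = reTr (A * sld ρ B) := by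
  rw [sldMetric, reTr_mul_eq_symInner hρ hA (isSelfAdjoint_sld hρ hB)]

/-- The superoperator inverse to `ρ ∘ ·` is symmetric for the trace form. -/
theorem reTr_mul_sld {ρ : Op H} (hρ : ρ ∈ StateSpace H) (A B : Op H) :
    reTr (A * sld ρ B) = reTr (sld ρ A * B) := by
  conv_lhs => rw [← jordan_sld hρ A]
  conv_rhs => rw [← jordan_sld hρ B]
  exact reTr_jordan_mul _ _ _

theorem reTr_mul_sld_of_tangent {ρ B : Op H} (hρ : ρ ∈ StateSpace H) (hB : B ∈ TangentOps H) :
    reTr (ρ * sld ρ B) = 0 := by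
  rw [← reTr_jordan, jordan_sld hρ, reTr_apply, hB.2, Complex.zero_re]

theorem sldMetric_self_pos {ρ A : Op H} (hρ : ρ ∈ StateSpace H) (hA : A ∈ TangentOps H)
    (h : sldMetric ρ A A ≤ 0) : A = 0 := by
  have hL := isSelfAdjoint_sld hρ hA.1
  have h1 : reTr (star (sld ρ A) * (ρ * sld ρ A)) ≤ 0 := by
    rw [hL.star_eq, reTr_mul_comm]
    exact h
  rw [← jordan_sld hρ A, eq_zero_of_reTr hρ _ h1, map_zero]

theorem eq_of_sldMetric {ρ V W : Op H} (hρ : ρ ∈ StateSpace H) (hV : V ∈ TangentOps H)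
    (hW : W ∈ TangentOps H)
    (h : ∀ Z ∈ TangentOps H, sldMetric ρ V Z = sldMetric ρ W Z) : V = W := by
  have hVW := (TangentOps H).sub_mem hV hW
  have h1 := h _ hVW
  rw [sldMetric_eq hρ hV.1 hVW.1, sldMetric_eq hρ hW.1 hVW.1] at h1
  refine sub_eq_zero.1 (sldMetric_self_pos hρ hVW ?_)
  rw [sldMetric_eq hρ hVW.1 hVW.1, sub_mul, map_sub, h1, sub_self]

/-- A state stays a state when it moves a little in a tangent direction. -/
theorem eventually_mem_stateSpace {ρ A : Op H} (hρ : ρ ∈ StateSpace H)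
    (hA : A ∈ TangentOps H) : ∀ᶠ t : ℝ in nhds 0, ρ + t • A ∈ StateSpace H := by
  have htr : ∀ t : ℝ, tr (ρ + t • A) = 1 := fun t => by
    rw [map_add tr, ← Complex.coe_smul, map_smul tr, hA.2, smul_zero, add_zero, hρ.2.2]
  have hsa : ∀ t : ℝ, IsSelfAdjoint (ρ + t • A) := fun t =>
    hρ.1.add (by rw [IsSelfAdjoint, star_smul, star_trivial, hA.1.star_eq])
  have hpos : ∀ᶠ t : ℝ in nhds 0, ∀ x ∈ Metric.sphere (0 : H) 1,
      0 < (inner ℂ x ((ρ + t • A) x)).re := by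
    have hc : Continuous fun p : ℝ × H => (inner ℂ p.2 ((ρ + p.1 • A) p.2)).re := by
      have : (fun p : ℝ × H => (inner ℂ p.2 ((ρ + p.1 • A) p.2)).re) =
        fun p : ℝ × H => (inner ℂ p.2 (ρ p.2 + p.1 • A p.2)).re := rfl
      rw [this]
      fun_prop
    refine (isCompact_sphere (0 : H) 1).eventually_forall_of_forall_eventually fun x hx => ?_
    refine hc.continuousAt.eventually (lt_mem_nhds ?_)
    have hx0 : x ≠ 0 := by
      rintro rfl
      simp at hx
    simpa using hρ.2.1 x hx0
  filter_upwards [hpos] with t ht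
  refine ⟨hsa t, fun x hx => ?_, htr t⟩
  have hn : (‖x‖ : ℝ) ≠ 0 := norm_ne_zero_iff.2 hx
  have h1 := ht ((‖x‖⁻¹ : ℝ) • x) (by
    rw [mem_sphere_zero_iff_norm, norm_smul, norm_inv, norm_norm, inv_mul_cancel₀ hn])
  have h2 : (inner ℂ ((‖x‖⁻¹ : ℝ) • x) ((ρ + t • A) ((‖x‖⁻¹ : ℝ) • x))).re
      = ‖x‖⁻¹ * (‖x‖⁻¹ * (inner ℂ x ((ρ + t • A) x)).re) := by
    rw [← Complex.coe_smul, map_smul, inner_smul_left, inner_smul_right, Complex.conj_ofReal,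
      Complex.re_ofReal_mul, Complex.re_ofReal_mul]
  rw [h2] at h1
  have h3 : (0 : ℝ) < ‖x‖⁻¹ := by positivity
  exact pos_of_mul_pos_right (pos_of_mul_pos_right h1 h3.le) h3.le

end Facts

section Connection

theorem hasDerivAt_line {E : Type*} [NormedAddCommGroup E] [NormedSpace ℝ E] (ρ A : E) :
    HasDerivAt (fun t : ℝ => ρ + t • A) A 0 := by
  simpa using ((hasDerivAt_id (0 : ℝ)).smul_const A).const_add ρ

theorem hasDerivAt_inverse_apply {E : Type*} [NormedAddCommGroup E] [NormedSpace ℝ E]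
    [CompleteSpace E] {T : ℝ → E →L[ℝ] E} {T' : E →L[ℝ] E} {Z : ℝ → E} {Z' : E} {t : ℝ}
    (hT : HasDerivAt T T' t) (hZ : HasDerivAt Z Z' t) (hu : IsUnit (T t)) :
    HasDerivAt (fun s => Ring.inverse (T s) (Z s))
      (Ring.inverse (T t) (Z' - T' (Ring.inverse (T t) (Z t)))) t := by
  obtain ⟨u, hu⟩ := hu
  have h2 := hasFDerivAt_ringInverse (𝕜 := ℝ) (R := E →L[ℝ] E) u
  rw [hu] at h2
  have h3 := (h2.comp_hasDerivAt t hT).clm_apply hZ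
  refine h3.congr_deriv ?_
  rw [Function.comp_apply, ← hu, Ring.inverse_unit, map_sub, sub_eq_neg_add]
  rfl

variable {H : Type*} [NormedAddCommGroup H] [InnerProductSpace ℂ H] [FiniteDimensional ℂ H]

theorem lineDeriv_eq_of_hasFDerivWithinAt {F : Type*} [NormedAddCommGroup F] [NormedSpace ℝ F]
    {Y : Op H → F} {D : Op H →L[ℝ] F} {ρ A : Op H} (hρ : ρ ∈ StateSpace H)
    (hA : A ∈ TangentOps H) (hY : HasFDerivWithinAt Y D (StateSpace H) ρ) :
    HasDerivAt (fun t : ℝ => Y (ρ + t • A)) (D A) 0 :=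
  hY.comp_hasDerivAt_of_eq (0 : ℝ) (hasDerivAt_line ρ A) (eventually_mem_stateSpace hρ hA)
    (by simp)

theorem IsVectorField.hasDerivAt {Y : Op H → Op H} (hY : IsVectorField Y) {ρ A : Op H}
    (hρ : ρ ∈ StateSpace H) (hA : A ∈ TangentOps H) :
    HasDerivAt (fun t : ℝ => Y (ρ + t • A)) (lineDeriv ℝ Y ρ A) 0 := by
  have h := ((hY.1 ρ hρ).differentiableWithinAt (by simp)).hasFDerivWithinAt
  have h1 := lineDeriv_eq_of_hasFDerivWithinAt hρ hA h
  rwa [show lineDeriv ℝ Y ρ A = _ from h1.deriv]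

theorem isVectorField_const {A : Op H} (hA : A ∈ TangentOps H) : IsVectorField fun _ => A :=
  ⟨contDiffOn_const, fun _ _ => hA⟩

theorem isClosed_tangentOps : IsClosed (TangentOps H : Set (Op H)) := by
  have h : (TangentOps H : Set (Op H)) = {A | star A = A} ∩ {A | tr A = 0} := rfl
  rw [h]
  exact (isClosed_eq continuous_star continuous_id).inter
    (isClosed_eq tr.continuous continuous_const)

theorem IsVectorField.lineDeriv_mem {Y : Op H → Op H} (hY : IsVectorField Y) {ρ A : Op H}
    (hρ : ρ ∈ StateSpace H) (hA : A ∈ TangentOps H) : lineDeriv ℝ Y ρ A ∈ TangentOps H := by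
  have h := (hY.hasDerivAt hρ hA).tendsto_slope
  refine isClosed_tangentOps.mem_of_tendsto h ?_
  filter_upwards [(eventually_mem_stateSpace hρ hA).filter_mono nhdsWithin_le_nhds] with t ht
  rw [slope_def_module]
  refine (TangentOps H).smul_mem _ ((TangentOps H).sub_mem (hY.2 _ ht) (hY.2 _ ?_))
  simpa using hρ

/-- The derivative of `σ ↦ L_{Z(σ)}` along a curve. -/
theorem hasDerivAt_sld {c Z : ℝ → Op H} {A Z' : Op H} {t : ℝ} (hc : HasDerivAt c A t)
    (hZ : HasDerivAt Z Z' t) (hρ : c t ∈ StateSpace H) :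
    HasDerivAt (fun s => sld (c s) (Z s))
      (sld (c t) (Z' - jordan A (sld (c t) (Z t)))) t := by
  have h1 : HasDerivAt (fun s => jordan (c s)) (jordan A) t :=
    HasFDerivAt.comp_hasDerivAt (l := fun A : Op H => jordan A) t
      (jordan (H := H)).hasFDerivAt hc
  exact hasDerivAt_inverse_apply h1 hZ (isUnit_jordan hρ)

/-- The value of the e-covariant derivative in terms of the ordinary derivative `D` of the
field `B` in the direction `A`. -/
def eValue (ρ A B D : Op H) : Op H := D - jordan A (sld ρ B) + sldMetric ρ A B • ρ

theorem eValue_mem {ρ A B D : Op H} (hρ : ρ ∈ StateSpace H) (hA : A ∈ TangentOps H)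
    (hB : B ∈ TangentOps H) (hD : D ∈ TangentOps H) : eValue ρ A B D ∈ TangentOps H := by
  have hj := isSelfAdjoint_jordan hA.1 (isSelfAdjoint_sld hρ hB.1)
  have hs : IsSelfAdjoint (sldMetric ρ A B • ρ) := by
    rw [IsSelfAdjoint, star_smul, star_trivial (sldMetric ρ A B), hρ.1.star_eq]
  refine ⟨(hD.1.sub hj).add hs, ?_⟩
  rw [eValue, map_add tr, map_sub tr, hD.2, tr_eq_reTr hj, reTr_jordan, ← Complex.coe_smul,
    map_smul tr, hρ.2.2, sldMetric_eq hρ hA.1 hB.1]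
  simp

theorem isDualValue_eValue {X Y : Op H → Op H} (hX : IsVectorField X) (hY : IsVectorField Y)
    {ρ : Op H} (hρ : ρ ∈ StateSpace H) :
    IsDualValue X Y ρ (eValue ρ (X ρ) (Y ρ) (mConn X Y ρ)) := by
  have hXρ := hX.2 ρ hρ
  have hYρ := hY.2 ρ hρ
  have hW : eValue ρ (X ρ) (Y ρ) (mConn X Y ρ) ∈ TangentOps H :=
    eValue_mem hρ hXρ hYρ (hY.lineDeriv_mem hρ hXρ)
  refine ⟨hW, fun Z hZ => ?_⟩
  have hZρ := hZ.2 ρ hρ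
  have e0 : ρ + (0 : ℝ) • X ρ = ρ := by simp
  have hc := hasDerivAt_line ρ (X ρ)
  have h1 := hasDerivAt_sld hc (hZ.hasDerivAt hρ hXρ) (by simpa using hρ)
  have h2 := (reTr (H := H)).hasFDerivAt.comp_hasDerivAt (0 : ℝ) ((hY.hasDerivAt hρ hXρ).mul h1)
  have h3 : (fun t : ℝ => sldMetric (ρ + t • X ρ) (Y (ρ + t • X ρ)) (Z (ρ + t • X ρ)))
      =ᶠ[nhds 0] (reTr (H := H)) ∘ ((fun t : ℝ => Y (ρ + t • X ρ)) *
        fun t : ℝ => sld (ρ + t • X ρ) (Z (ρ + t • X ρ))) := by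
    filter_upwards [eventually_mem_stateSpace hρ hXρ] with t ht
    exact sldMetric_eq ht (hY.2 _ ht).1 (hZ.2 _ ht).1
  have h4 := (h2.congr_of_eventuallyEq h3).deriv
  have h5 : lineDeriv ℝ (fun σ => sldMetric σ (Y σ) (Z σ)) ρ (X ρ) =
      deriv (fun t : ℝ => sldMetric (ρ + t • X ρ) (Y (ρ + t • X ρ)) (Z (ρ + t • X ρ))) 0 := rfl
  rw [h5, h4]
  simp only [e0]
  have hm : mConn X Z ρ ∈ TangentOps H := hZ.lineDeriv_mem hρ hXρ
  rw [sldMetric_eq hρ hW.1 hZρ.1, sldMetric_eq hρ hYρ.1 hm.1, eValue, add_mul, sub_mul,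
    map_add, map_add, map_sub, smul_mul_assoc, map_smul, reTr_mul_sld_of_tangent hρ hZρ,
    smul_zero, add_zero]
  have h6 : sld ρ (lineDeriv ℝ Z ρ (X ρ) - jordan (X ρ) (sld ρ (Z ρ))) =
      sld ρ (lineDeriv ℝ Z ρ (X ρ)) - sld ρ (jordan (X ρ) (sld ρ (Z ρ))) := map_sub _ _ _
  rw [h6, mul_sub, map_sub, reTr_mul_sld hρ (Y ρ) (jordan (X ρ) (sld ρ (Z ρ))),
    reTr_jordan_mul]
  have h7 := reTr_jordan_mul (X ρ) (sld ρ (Y ρ)) (sld ρ (Z ρ))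
  rw [reTr_jordan_mul] at h7
  simp only [mConn]
  ring

theorem IsDualValue.unique {X Y : Op H → Op H} {ρ V W : Op H} (hρ : ρ ∈ StateSpace H)
    (hV : IsDualValue X Y ρ V) (hW : IsDualValue X Y ρ W) : V = W :=
  eq_of_sldMetric hρ hV.1 hW.1 fun Z hZ => by
    have h1 := hV.2 _ (isVectorField_const hZ)
    have h2 := hW.2 _ (isVectorField_const hZ)
    linarith

/-- The dual connection exists and is unique: for vector fields `X`, `Y` on `𝒮(H)` the tangent
vector `∇⁽ᵉ⁾_X Y` at `ρ` is the one and only one that satisfies the duality relation. -/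
theorem isDualValue_iff {X Y : Op H → Op H} (hX : IsVectorField X) (hY : IsVectorField Y)
    {ρ W : Op H} (hρ : ρ ∈ StateSpace H) : IsDualValue X Y ρ W ↔ W = eConn X Y ρ := by
  have h : IsDualValue X Y ρ (eConn X Y ρ) :=
    Classical.epsilon_spec ⟨_, isDualValue_eValue hX hY hρ⟩
  exact ⟨fun hW => hW.unique hρ h, fun hW => hW ▸ h⟩

theorem eConn_eq {X Y : Op H → Op H} (hX : IsVectorField X) (hY : IsVectorField Y)
    {ρ : Op H} (hρ : ρ ∈ StateSpace H) :
    eConn X Y ρ = eValue ρ (X ρ) (Y ρ) (mConn X Y ρ) :=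
  ((isDualValue_iff hX hY hρ).1 (isDualValue_eValue hX hY hρ)).symm

theorem eChristoffel_eq {ρ A B : Op H} (hρ : ρ ∈ StateSpace H) (hA : A ∈ TangentOps H)
    (hB : B ∈ TangentOps H) : eChristoffel ρ A B = eValue ρ A B 0 := by
  have h : mConn (fun _ => A) (fun _ => B) ρ = 0 := by simp [mConn, lineDeriv]
  rw [eChristoffel, eConn_eq (isVectorField_const hA) (isVectorField_const hB) hρ, h]

/-- The coordinate expression `∇⁽ᵉ⁾_X Y = D_X Y + Γ(X, Y)` of the e-connection. -/
theorem eConn_eq_add_eChristoffel {X Y : Op H → Op H} (hX : IsVectorField X)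
    (hY : IsVectorField Y) {ρ : Op H} (hρ : ρ ∈ StateSpace H) :
    eConn X Y ρ = lineDeriv ℝ Y ρ (X ρ) + eChristoffel ρ (X ρ) (Y ρ) := by
  rw [eConn_eq hX hY hρ, eChristoffel_eq hρ (hX.2 ρ hρ) (hY.2 ρ hρ), eValue, eValue, mConn]
  abel

end Connection

section Submanifolds

variable {H : Type*} [NormedAddCommGroup H] [InnerProductSpace ℂ H] [FiniteDimensional ℂ H]
variable {n : ℕ} {M : Type*} [TopologicalSpace M] [ChartedSpace (EuclideanSpace ℝ (Fin n)) M]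

/-- The differential of a map `Y` from the `n`-dimensional manifold `M` into the operators,
applied to the tangent vector `v` of `M` at `p`. -/
def dOp (Y : M → Op H) (p : M) (v : TangentSpace (𝓡 n) p) : Op H :=
  (mfderiv (𝓡 n) 𝓘(ℝ, Op H) Y p : TangentSpace (𝓡 n) p →L[ℝ] Op H) v

/-- The image `ι_* v` of a tangent vector of `M` under the inclusion map `ι`. -/
def push (ι : M → StateSpace H) (p : M) (v : TangentSpace (𝓡 n) p) : Op H :=
  dOp (fun q => (ι q : Op H)) p v

variable (n) in
/-- `M`, with the inclusion map `ι`, is an `n`-dimensional submanifold of `𝒮(H)`: `ι` is a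
smooth injective immersion. -/
structure IsSubmanifold (ι : M → StateSpace H) : Prop where
  contMDiff : ContMDiff (𝓡 n) 𝓘(ℝ, Op H) ∞ fun p => (ι p : Op H)
  injective : Function.Injective ι
  immersion : ∀ p : M, Function.Injective (push (n := n) ι p)

/-- The e-covariant derivative `∇⁽ᵉ⁾_v Y` at `p`, for a tangent vector `v` of `M` at `p` and a
field `Y` along `M` of tangent vectors of `𝒮(H)`: the map that the e-connection of `𝒮(H)`
induces (see `eConnAlong_eq_eConn`). -/
def eConnAlong (ι : M → StateSpace H) (p : M) (v : TangentSpace (𝓡 n) p) (Y : M → Op H) : Op H :=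
  dOp Y p v + eChristoffel (ι p) (push ι p v) (Y p)

/-- A smooth vector field on `M`. -/
def IsSmoothField [IsManifold (𝓡 n) ∞ M] (X : ∀ p : M, TangentSpace (𝓡 n) p) : Prop :=
  ContMDiff (𝓡 n) (𝓡 n).tangent ∞ fun p => (⟨p, X p⟩ : TangentBundle (𝓡 n) M)

variable (n) in
/-- `M` is e-autoparallel in `𝒮(H)`: for all smooth vector fields `X`, `Y` on `M`, the field
`∇⁽ᵉ⁾_X Y` is (the image of) a smooth vector field on `M`. -/
def IsEAutoparallel [IsManifold (𝓡 n) ∞ M] (ι : M → StateSpace H) : Prop :=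
  ∀ X Y : ∀ p : M, TangentSpace (𝓡 n) p, IsSmoothField X → IsSmoothField Y →
    ∃ W : ∀ p : M, TangentSpace (𝓡 n) p, IsSmoothField W ∧
      ∀ p, eConnAlong ι p (X p) (fun q => push ι q (Y q)) = push ι p (W p)

/-- The gradient vector at `p` that corresponds, under the metric induced on `M`, to the
cotangent vector `α` (see `gradVec_spec` for existence and uniqueness). -/
def gradVec (ι : M → StateSpace H) (p : M) (α : TangentSpace (𝓡 n) p →L[ℝ] ℝ) :
    TangentSpace (𝓡 n) p :=
  Classical.epsilon fun v => ∀ w, α w = sldMetric (ι p) (push ι p v) (push ι p w)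

/-- The squared norm `‖α‖²` of a cotangent vector, that is `g(v, v)` for the tangent vector `v`
that corresponds to `α`. -/
def cotangentNormSq (ι : M → StateSpace H) (p : M) (α : TangentSpace (𝓡 n) p →L[ℝ] ℝ) : ℝ :=
  sldMetric (ι p) (push ι p (gradVec ι p α)) (push ι p (gradVec ι p α))

theorem IsSubmanifold.push_mem {ι : M → StateSpace H} (hι : IsSubmanifold n ι) (p : M)
    (v : TangentSpace (𝓡 n) p) : push ι p v ∈ TangentOps H := by
  have h : HasMFDerivAt (𝓡 n) 𝓘(ℝ, Op H) (fun q => (ι q : Op H)) p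
      (mfderiv (𝓡 n) 𝓘(ℝ, Op H) (fun q => (ι q : Op H)) p) :=
    (hι.contMDiff.mdifferentiableAt (by simp)).hasMFDerivAt
  constructor
  · let S : Op H →L[ℝ] Op H := ((starL' ℝ : Op H ≃L[ℝ] Op H) : Op H →L[ℝ] Op H)
    have h1 := (S.hasMFDerivAt (x := (ι p : Op H))).comp p h
    have h2 : (⇑S ∘ fun q => (ι q : Op H)) = fun q => (ι q : Op H) := by
      funext q
      exact (ι q).2.1.star_eq
    rw [h2] at h1
    have h3 := congrArg (fun T : TangentSpace (𝓡 n) p →L[ℝ] Op H => T v)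
      (hasMFDerivAt_unique h1 h)
    exact h3
  · have h1 := ((tr (H := H)).restrictScalars ℝ).hasMFDerivAt (x := (ι p : Op H)) |>.comp p h
    have h2 : (⇑((tr (H := H)).restrictScalars ℝ) ∘ fun q => (ι q : Op H)) = fun _ => (1 : ℂ) := by
      funext q
      exact (ι q).2.2.2
    rw [h2] at h1
    have h3 := congrArg (fun T : TangentSpace (𝓡 n) p →L[ℝ] ℂ => T v)
      (hasMFDerivAt_unique h1 (hasMFDerivAt_const (1 : ℂ) p))
    exact h3

/-- If near `p` the field `Y` along `M` is the restriction of a vector field `Y'` on `𝒮(H)`,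
and `v` is the value of a vector field `X'` on `𝒮(H)`, then the induced e-covariant derivative
of `Y` is that of `Y'`. -/
theorem eConnAlong_eq_eConn {ι : M → StateSpace H} (hι : IsSubmanifold n ι) {p : M}
    {v : TangentSpace (𝓡 n) p} {Y : M → Op H} {X' Y' : Op H → Op H} (hX' : IsVectorField X')
    (hY' : IsVectorField Y') (hv : push ι p v = X' (ι p))
    (hY : Y =ᶠ[nhds p] fun q => Y' (ι q)) : eConnAlong ι p v Y = eConn X' Y' (ι p) := by
  have h : HasMFDerivAt (𝓡 n) 𝓘(ℝ, Op H) (fun q => (ι q : Op H)) p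
      (mfderiv (𝓡 n) 𝓘(ℝ, Op H) (fun q => (ι q : Op H)) p) :=
    (hι.contMDiff.mdifferentiableAt (by simp)).hasMFDerivAt
  have hD := ((hY'.1 _ (ι p).2).differentiableWithinAt (by simp)).hasFDerivWithinAt
  have h1 := HasMFDerivWithinAt.comp p (s := Set.univ) (g := Y') (f := fun q => (ι q : Op H))
    hD.hasMFDerivWithinAt h.hasMFDerivWithinAt fun q _ => (ι q).2
  have h2 := ((hasMFDerivWithinAt_univ.1 h1).congr_of_eventuallyEq hY).mfderiv
  have h3 := (lineDeriv_eq_of_hasFDerivWithinAt (ι p).2 (hX'.2 _ (ι p).2) hD).deriv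
  rw [eConn_eq_add_eChristoffel hX' hY' (ι p).2, eConnAlong, hv, hY.self_of_nhds]
  congr 1
  rw [dOp, h2]
  have h4 : lineDeriv ℝ Y' (ι p : Op H) (X' (ι p)) = _ := h3
  rw [h4, ← hv]
  rfl

theorem gradVec_spec {ι : M → StateSpace H} (hι : IsSubmanifold n ι) (p : M)
    (α : TangentSpace (𝓡 n) p →L[ℝ] ℝ) (v : TangentSpace (𝓡 n) p) :
    (∀ w, α w = sldMetric (ι p) (push ι p v) (push ι p w)) ↔ v = gradVec ι p α := by
  let P' : TangentSpace (𝓡 n) p →L[ℝ] Op H :=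
    mfderiv (𝓡 n) 𝓘(ℝ, Op H) (fun q => (ι q : Op H)) p
  let P : TangentSpace (𝓡 n) p →ₗ[ℝ] Op H := P'.toLinearMap
  let L : Op H →ₗ[ℝ] Op H := (Ring.inverse (jordan (ι p : Op H)) : Op H →L[ℝ] Op H)
  let B : TangentSpace (𝓡 n) p →ₗ[ℝ] TangentSpace (𝓡 n) p →ₗ[ℝ] ℝ :=
    LinearMap.mk₂ ℝ (fun v w => reTr (P v * L (P w)))
      (fun a b c => by rw [map_add, add_mul, map_add])
      (fun a b c => by rw [map_smul, smul_mul_assoc, map_smul])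
      (fun a b c => by rw [map_add, map_add, mul_add, map_add])
      (fun a b c => by rw [map_smul, map_smul, mul_smul_comm, map_smul])
  have hB : ∀ a b, B a b = sldMetric (ι p) (push ι p a) (push ι p b) := fun a b =>
    (sldMetric_eq (ι p).2 (hι.push_mem p a).1 (hι.push_mem p b).1).symm
  have hinj : Function.Injective B := by
    rw [← LinearMap.ker_eq_bot, LinearMap.ker_eq_bot']
    intro a ha
    have h0 : sldMetric (ι p) (push ι p a) (push ι p a) = 0 := by rw [← hB, ha]; rfl
    refine hι.immersion p ((sldMetric_self_pos (ι p).2 (hι.push_mem p a) h0.le).trans ?_)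
    exact (map_zero P).symm
  have : FiniteDimensional ℝ (TangentSpace (𝓡 n) p) :=
    inferInstanceAs (FiniteDimensional ℝ (EuclideanSpace ℝ (Fin n)))
  have hsurj : Function.Surjective B :=
    (LinearMap.injective_iff_surjective_of_finrank_eq_finrank
      (Subspace.dual_finrank_eq (K := ℝ) (V := TangentSpace (𝓡 n) p)).symm).1 hinj
  have hg : ∀ w, α w = sldMetric (ι p) (push ι p (gradVec ι p α)) (push ι p w) := by
    refine Classical.epsilon_spec
      (p := fun v => ∀ w, α w = sldMetric (ι p) (push ι p v) (push ι p w)) ?_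
    obtain ⟨u, hu⟩ := hsurj (α : TangentSpace (𝓡 n) p →ₗ[ℝ] ℝ)
    exact ⟨u, fun w => by rw [← hB, hu]; rfl⟩
  refine ⟨fun h => hinj (LinearMap.ext fun w => ?_), fun h => h ▸ hg⟩
  rw [hB, hB, ← h, ← hg]

end Submanifolds

section Estimation

variable {H : Type*} [NormedAddCommGroup H] [InnerProductSpace ℂ H] [FiniteDimensional ℂ H]

variable (H) in
/-- A positive operator-valued measure on the Borel sets of the real line: an estimator of a
real quantity. -/
structure POVM where
  /-- The operator-valued measure. -/
  effect : MeasureTheory.VectorMeasure ℝ (Op H)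
  isPositive : ∀ s, (effect s).IsPositive
  effect_univ : effect Set.univ = 1

/-- The signed measure `s ↦ Tr (ρ Λ(s))`. -/
def POVM.signedOutcome (Λ : POVM H) (ρ : Op H) : MeasureTheory.SignedMeasure ℝ :=
  Λ.effect.mapRange (reTr.comp (ContinuousLinearMap.mul ℝ (Op H) ρ) : Op H →L[ℝ] ℝ).toAddMonoidHom
    (reTr.comp (ContinuousLinearMap.mul ℝ (Op H) ρ) : Op H →L[ℝ] ℝ).continuous

theorem POVM.signedOutcome_apply (Λ : POVM H) (ρ : Op H) (s : Set ℝ) :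
    Λ.signedOutcome ρ s = reTr (ρ * Λ.effect s) := rfl

theorem reTr_mul_nonneg {ρ P : Op H} (hρ : ρ ∈ StateSpace H) (hP : P.IsPositive) :
    0 ≤ reTr (ρ * P) := by
  have hs := ContinuousLinearMap.isSelfAdjoint_iff_isSymmetric.1 hρ.1
  rw [reTr_mul_comm, reTr_eq_sum (hs.eigenvectorBasis rfl)]
  refine Finset.sum_nonneg fun i _ => ?_
  have h1 : ρ (hs.eigenvectorBasis rfl i) =
      (hs.eigenvalues rfl i : ℂ) • hs.eigenvectorBasis rfl i := hs.apply_eigenvectorBasis rfl i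
  have h2 := inner_nonneg_of_mem hρ (hs.eigenvectorBasis rfl i)
  rw [h1, inner_smul_right, Complex.re_ofReal_mul, inner_self_eq_norm_sq_to_K,
    (hs.eigenvectorBasis rfl).norm_eq_one] at h2
  rw [mul_apply_eq_comp, h1, map_smul, inner_smul_right, Complex.re_ofReal_mul]
  refine mul_nonneg (by simpa using h2) ?_
  have h3 := hP.2 (hs.eigenvectorBasis rfl i)
  rwa [ContinuousLinearMap.reApplyInnerSelf_apply, ← inner_conj_symm, RCLike.conj_re] at h3

theorem POVM.signedOutcome_nonneg (Λ : POVM H) (ρ : StateSpace H) :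
    MeasureTheory.VectorMeasure.restrict 0 Set.univ ≤
      MeasureTheory.VectorMeasure.restrict (Λ.signedOutcome ρ) Set.univ := by
  rw [MeasureTheory.VectorMeasure.restrict_univ, MeasureTheory.VectorMeasure.restrict_univ]
  exact fun s _ => reTr_mul_nonneg ρ.2 (Λ.isPositive s)

/-- The distribution `Tr (ρ Λ(dt))` of the estimate in the state `ρ`. -/
def POVM.outcome (Λ : POVM H) (ρ : StateSpace H) : MeasureTheory.Measure ℝ :=
  (Λ.signedOutcome ρ).toMeasureOfZeroLE Set.univ MeasurableSet.univ (Λ.signedOutcome_nonneg ρ)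

theorem POVM.outcome_apply (Λ : POVM H) (ρ : StateSpace H) {s : Set ℝ} (hs : MeasurableSet s) :
    Λ.outcome ρ s = ENNReal.ofReal (reTr ((ρ : Op H) * Λ.effect s)) := by
  rw [POVM.outcome, MeasureTheory.SignedMeasure.toMeasureOfZeroLE_apply _ _ _ hs]
  simp only [Set.univ_inter, POVM.signedOutcome_apply]
  exact (ENNReal.ofReal_eq_coe_nnreal _).symm

/-- The expectation `E_ρ(Λ)` of an estimator. -/
def POVM.expectation (Λ : POVM H) (ρ : StateSpace H) : ℝ := ∫ t, t ∂(Λ.outcome ρ)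

/-- The mean squared error `V_ρ(Λ)` of an estimator of the value `c`, possibly infinite. -/
def POVM.meanSquaredError (Λ : POVM H) (ρ : StateSpace H) (c : ℝ) : ENNReal :=
  ∫⁻ t, ENNReal.ofReal ((t - c) ^ 2) ∂(Λ.outcome ρ)

variable {n : ℕ} {M : Type*} [TopologicalSpace M] [ChartedSpace (EuclideanSpace ℝ (Fin n)) M]

/-- `Λ` is locally unbiased for the function `f` at `p`: the expectation exists, it equals `f`
at `p`, and it has the same differential as `f` at `p`. -/
def IsLocallyUnbiased (ι : M → StateSpace H) (Λ : POVM H) (f : C^∞⟮𝓡 n, M; ℝ⟯) (p : M) : Prop :=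
  MeasureTheory.Integrable (fun t : ℝ => t) (Λ.outcome (ι p)) ∧
    Λ.expectation (ι p) = f p ∧
    HasMFDerivAt (𝓡 n) 𝓘(ℝ, ℝ) (fun q => Λ.expectation (ι q)) p (mfderiv (𝓡 n) 𝓘(ℝ, ℝ) f p)

/-- `Λ` is locally efficient for `f` at `p`: it is locally unbiased and its mean squared error
is the minimal one, `‖(df)_p‖²`. -/
def IsLocallyEfficient (ι : M → StateSpace H) (Λ : POVM H) (f : C^∞⟮𝓡 n, M; ℝ⟯) (p : M) : Prop :=
  IsLocallyUnbiased ι Λ f p ∧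
    Λ.meanSquaredError (ι p) (f p) =
      ENNReal.ofReal (cotangentNormSq ι p (mfderiv (𝓡 n) 𝓘(ℝ, ℝ) f p))

/-- The set `ℰ(M)` of the smooth functions on `M` that admit an efficient estimator, that is one
estimator that is locally efficient at every point of `M`. -/
def efficientFunctions (ι : M → StateSpace H) : Set C^∞⟮𝓡 n, M; ℝ⟯ :=
  {f | ∃ Λ : POVM H, ∀ p, IsLocallyEfficient ι Λ f p}

end Estimation

end QuantumInfoGeom

end

/-! To each point p of M attach K_p = `sldSpan n ι p`, the real span of 1 and the symmetric
logarithmic derivatives L_v, v in T_pM. The trace form at p separates its two parts, so dim K_p = n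
+ 1. Both conditions of the theorem say that K_p does not depend on p.

Estimation: f has an efficient estimator exactly when f(p) = Tr(ι(p)F) for a single F lying in every
K_p. Given an efficient Λ, take F = ∫ t Λ(dt). It has the same expectations and, by Kadison's
inequality, no larger variance, so the variance of F at p is at most ‖df‖². Equality in the
Cramér–Rao inequality then forces F - f(p) = L_v with v the gradient of f
(`POVM.exists_firstMoment`, `mem_sldSpan_of_variance_le`). Conversely, the spectral measure of such
an F is efficient (`mem_efficientFunctions_of_mem_sldSpan`). Hence ℰ(M) is the image of the
intersection of all K_p under F ↦ Tr(ι(·)F). This map is injective on each K_p, so dim ℰ(M) = n + 1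
exactly when the K_p coincide.

Geometry: differentiating B = ρ ∘ L_B turns the e-connection into ∇⁽ᵉ⁾_v B = ρ ∘ (∂_v L_B + g(v,
B)·1) (`eConnAlong_eq_jordan`). Thus M is e-autoparallel when the derivatives of the fields L_Y
along M stay in K_p. If the K_p are constant, this is clear. In the other direction, a
differentiable family of injective linear maps whose derivatives take values in their own ranges has
locally constant range (`eventually_range_eq`), and connectedness makes K_p constant. -/

noncomputable section

namespace QuantumInfoGeom

/-! ### First moment of a POVM and Kadison's inequality -/

section FirstMoment

open MeasureTheory Filter Topology

variable {H : Type*} [NormedAddCommGroup H] [InnerProductSpace ℂ H] [FiniteDimensional ℂ H]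

/-- Every Hermitian operator is a real linear combination of two states, one of them given. -/
theorem exists_eq_smul_add_smul {ρ A : Op H} (hρ : ρ ∈ StateSpace H) (hA : IsSelfAdjoint A) :
    ∃ (a b : ℝ) (σ : StateSpace H), A = a • ρ + b • (σ : Op H) := by
  have hρs : IsSelfAdjoint (reTr A • ρ) := by
    rw [IsSelfAdjoint, star_smul, star_trivial (reTr A), hρ.1.star_eq]
  have hA0 : A - reTr A • ρ ∈ TangentOps H := by
    refine ⟨hA.sub hρs, ?_⟩
    rw [map_sub tr, ← Complex.coe_smul, map_smul tr, hρ.2.2, tr_eq_reTr hA]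
    simp
  -- For small t ≠ 0 the operator ρ + t(A - Tr(A)ρ) is a state; solving for A gives the
  -- coefficients.
  obtain ⟨t, ht, h0⟩ := (((eventually_mem_stateSpace hρ hA0).filter_mono
    nhdsWithin_le_nhds).and (self_mem_nhdsWithin (s := {(0 : ℝ)}ᶜ))).exists
  have h0' : t ≠ 0 := h0
  refine ⟨reTr A - t⁻¹, t⁻¹, ⟨_, ht⟩, ?_⟩
  rw [smul_add, smul_smul, inv_mul_cancel₀ h0', one_smul, sub_smul]
  abel

theorem POVM.outcome_real (Λ : POVM H) (σ : StateSpace H) {s : Set ℝ} (hs : MeasurableSet s) :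
    (Λ.outcome σ).real s = reTr ((σ : Op H) * Λ.effect s) := by
  rw [Measure.real, Λ.outcome_apply σ hs,
    ENNReal.toReal_ofReal (reTr_mul_nonneg σ.2 (Λ.isPositive s))]

theorem reTr_state (σ : StateSpace H) : reTr (σ : Op H) = 1 := by
  rw [reTr_apply, σ.2.2.2, Complex.one_re]

instance (Λ : POVM H) (σ : StateSpace H) : IsProbabilityMeasure (Λ.outcome σ) := ⟨by
  rw [Λ.outcome_apply σ MeasurableSet.univ, Λ.effect_univ, mul_one, reTr_state,
    ENNReal.ofReal_one]⟩

/-- The outcome distributions in any two states are mutually bounded. -/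
theorem POVM.outcome_le_smul (Λ : POVM H) (ρ σ : StateSpace H) :
    ∃ C : ENNReal, C ≠ ⊤ ∧ Λ.outcome σ ≤ C • Λ.outcome ρ := by
  -- Moving from ρ a little away from σ gives a state τ = ρ + t(ρ - σ) with t > 0. Then tσ = (1 +
  -- t)ρ - τ, and dropping τ leaves the bound with constant (1 + t)/t.
  have hA : (ρ - σ : Op H) ∈ TangentOps H := by
    refine ⟨ρ.2.1.sub σ.2.1, ?_⟩
    rw [map_sub tr, ρ.2.2.2, σ.2.2.2, sub_self]
  obtain ⟨t, ht, h0⟩ := (((eventually_mem_stateSpace ρ.2 hA).filter_mono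
    nhdsWithin_le_nhds).and (self_mem_nhdsWithin (s := Set.Ioi (0 : ℝ)))).exists
  have h0' : 0 < t := h0
  refine ⟨ENNReal.ofReal (t⁻¹ * (1 + t)), ENNReal.ofReal_ne_top, Measure.le_iff.2 fun s hs => ?_⟩
  rw [Measure.smul_apply, smul_eq_mul, Λ.outcome_apply σ hs, Λ.outcome_apply ρ hs,
    ← ENNReal.ofReal_mul (by positivity)]
  refine ENNReal.ofReal_le_ofReal ?_
  have h1 := reTr_mul_nonneg ht (Λ.isPositive s)
  rw [add_mul, map_add, smul_mul_assoc, map_smul, sub_mul, map_sub, smul_eq_mul] at h1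
  rw [mul_assoc, inv_mul_eq_div, le_div_iff₀ h0']
  linarith

/-- The operator `∫ φ(t) Λ(dt)` for a simple function `φ`. -/
def POVM.simpleIntegral (Λ : POVM H) (φ : SimpleFunc ℝ ℝ) : Op H :=
  ∑ x ∈ φ.range, x • Λ.effect (φ ⁻¹' {x})

theorem POVM.isSelfAdjoint_simpleIntegral (Λ : POVM H) (φ : SimpleFunc ℝ ℝ) :
    IsSelfAdjoint (Λ.simpleIntegral φ) := by
  refine isSelfAdjoint_sum _ fun x _ => ?_
  rw [IsSelfAdjoint, star_smul, star_trivial x, (Λ.isPositive _).isSelfAdjoint.star_eq]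

omit [FiniteDimensional ℂ H] in
theorem POVM.sum_effect_fiber (Λ : POVM H) (φ : SimpleFunc ℝ ℝ) :
    ∑ x ∈ φ.range, Λ.effect (φ ⁻¹' {x}) = 1 := by
  have h := VectorMeasure.of_biUnion_finset (v := Λ.effect) (s := φ.range)
    (f := fun x => φ ⁻¹' {x}) (fun x _ y _ hxy =>
      Disjoint.preimage _ (Set.disjoint_singleton.2 hxy)) (fun x _ => φ.measurableSet_fiber x)
  rw [← h, ← Λ.effect_univ]
  congr 1
  ext t
  simp

theorem POVM.integral_simpleFunc (Λ : POVM H) (σ : StateSpace H) (φ : SimpleFunc ℝ ℝ) :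
    ∫ t, φ t ∂(Λ.outcome σ) = reTr ((σ : Op H) * Λ.simpleIntegral φ) := by
  rw [← SimpleFunc.integral_eq_integral φ (SimpleFunc.integrable_of_isFiniteMeasure φ),
    SimpleFunc.integral_eq, POVM.simpleIntegral, Finset.mul_sum, map_sum]
  refine Finset.sum_congr rfl fun x _ => ?_
  rw [Λ.outcome_real σ (φ.measurableSet_fiber x), mul_smul_comm, map_smul, smul_eq_mul,
    smul_eq_mul, mul_comm]

theorem POVM.integral_simpleFunc_sq (Λ : POVM H) (σ : StateSpace H) (φ : SimpleFunc ℝ ℝ) :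
    ∫ t, φ t ^ 2 ∂(Λ.outcome σ) =
      ∑ x ∈ φ.range, x ^ 2 * reTr ((σ : Op H) * Λ.effect (φ ⁻¹' {x})) := by
  have h := SimpleFunc.integral_eq_integral (μ := Λ.outcome σ) (φ.map fun x => x ^ 2)
    (SimpleFunc.integrable_of_isFiniteMeasure _)
  rw [SimpleFunc.map_integral _ _ (SimpleFunc.integrable_of_isFiniteMeasure φ) (by simp)] at h
  simp only [SimpleFunc.map_apply] at h
  rw [← h]
  refine Finset.sum_congr rfl fun x _ => ?_
  rw [Λ.outcome_real σ (φ.measurableSet_fiber x), smul_eq_mul, mul_comm]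

/-- Kadison's inequality for `∫ φ(t) Λ(dt)`, in expectation. -/
theorem POVM.simpleIntegral_sq_nonneg (Λ : POVM H) (σ : StateSpace H) (φ : SimpleFunc ℝ ℝ)
    {G : Op H} (hG : IsSelfAdjoint G) :
    0 ≤ ∫ t, φ t ^ 2 ∂(Λ.outcome σ) - 2 * reTr (jordan (σ : Op H) G * Λ.simpleIntegral φ) +
      reTr ((σ : Op H) * (G * G)) := by
  -- With P_x the effect of the fiber over x, the operators (x - G)P_x(x - G) are positive. Summing
  -- over x and using ΣP_x = 1 gives the inequality, with no projection property of the effects.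
  have h1 : ∀ x : ℝ, 0 ≤ reTr ((σ : Op H) *
      ((x • 1 - G) * Λ.effect (φ ⁻¹' {x}) * (x • 1 - G))) := fun x => by
    refine reTr_mul_nonneg σ.2 ?_
    have hs : IsSelfAdjoint (x • 1 - G) := by
      refine IsSelfAdjoint.sub ?_ hG
      rw [IsSelfAdjoint, star_smul, star_one, star_trivial x]
    have h := (Λ.isPositive (φ ⁻¹' {x})).conj_adjoint (x • 1 - G)
    rw [← ContinuousLinearMap.star_eq_adjoint, hs.star_eq] at h
    exact h
  have h2 : ∀ x : ℝ, reTr ((σ : Op H) * ((x • 1 - G) * Λ.effect (φ ⁻¹' {x}) * (x • 1 - G))) =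
      x ^ 2 * reTr ((σ : Op H) * Λ.effect (φ ⁻¹' {x})) -
        2 * reTr (jordan (σ : Op H) G * (x • Λ.effect (φ ⁻¹' {x}))) +
        reTr ((σ : Op H) * (G * Λ.effect (φ ⁻¹' {x}) * G)) := fun x => by
    have e : (x • 1 - G) * Λ.effect (φ ⁻¹' {x}) * (x • 1 - G) =
        x ^ 2 • Λ.effect (φ ⁻¹' {x}) - (2 * x) • jordan G (Λ.effect (φ ⁻¹' {x})) +
          G * Λ.effect (φ ⁻¹' {x}) * G := by
      rw [jordan_apply]
      simp only [sub_mul, mul_sub, smul_mul_assoc, mul_smul_comm, one_mul, mul_one, smul_sub,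
        smul_smul, smul_add]
      module
    rw [e, mul_add, mul_sub, mul_smul_comm, mul_smul_comm, mul_smul_comm, map_add, map_sub,
      map_smul, map_smul, map_smul, jordan_comm (σ : Op H) G, reTr_jordan_mul]
    simp only [smul_eq_mul]
    ring
  have h3 := Finset.sum_nonneg fun x (_ : x ∈ φ.range) => h1 x
  simp only [h2, Finset.sum_add_distrib, Finset.sum_sub_distrib, ← Finset.mul_sum, ← map_sum] at h3
  rw [← Finset.sum_mul, ← Finset.mul_sum, Λ.sum_effect_fiber, mul_one] at h3
  rwa [Λ.integral_simpleFunc_sq]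

variable (H) in
/-- The expectations of a Hermitian operator in all states. -/
def stateExpectation : selfAdjoint.submodule ℝ (Op H) →ₗ[ℝ] (StateSpace H → ℝ) where
  toFun F σ := reTr ((σ : Op H) * (F : Op H))
  map_add' F G := by funext σ; simp [mul_add]
  map_smul' c F := by funext σ; simp

/-- Simple functions that approximate the identity of the line. -/
def simpleApprox (k : ℕ) : SimpleFunc ℝ ℝ :=
  SimpleFunc.approxOn id measurable_id Set.univ 0 (Set.mem_univ _) k

theorem tendsto_simpleApprox (t : ℝ) : Tendsto (fun k => simpleApprox k t) atTop (𝓝 t) :=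
  SimpleFunc.tendsto_approxOn measurable_id (Set.mem_univ _) (by simp)

theorem abs_simpleApprox_le (k : ℕ) (t : ℝ) : |simpleApprox k t| ≤ 2 * |t| := by
  have h := SimpleFunc.norm_approxOn_zero_le measurable_id (Set.mem_univ (0 : ℝ)) t k
  simp only [Real.norm_eq_abs, id_eq] at h
  rw [two_mul]
  exact h

theorem tendsto_integral_simpleApprox {μ : Measure ℝ} (hμ : Integrable (fun t : ℝ => t) μ) :
    Tendsto (fun k => ∫ t, simpleApprox k t ∂μ) atTop (𝓝 (∫ t, t ∂μ)) :=
  tendsto_integral_of_dominated_convergence (fun t => 2 * |t|)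
    (fun k => (simpleApprox k).stronglyMeasurable.aestronglyMeasurable) (hμ.abs.const_mul 2)
    (fun k => ae_of_all _ fun t => abs_simpleApprox_le k t)
    (ae_of_all _ fun t => tendsto_simpleApprox t)

theorem tendsto_integral_simpleApprox_sq {μ : Measure ℝ}
    (hμ : Integrable (fun t : ℝ => t ^ 2) μ) :
    Tendsto (fun k => ∫ t, simpleApprox k t ^ 2 ∂μ) atTop (𝓝 (∫ t, t ^ 2 ∂μ)) :=
  tendsto_integral_of_dominated_convergence (fun t => 4 * t ^ 2)
    (fun k => ((simpleApprox k).stronglyMeasurable.pow 2).aestronglyMeasurable) (hμ.const_mul 4)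
    (fun k => ae_of_all _ fun t => by
      rw [norm_pow, Real.norm_eq_abs]
      calc |simpleApprox k t| ^ 2 ≤ (2 * |t|) ^ 2 := by gcongr; exact abs_simpleApprox_le k t
        _ = 4 * t ^ 2 := by rw [mul_pow, sq_abs]; norm_num)
    (ae_of_all _ fun t => (tendsto_simpleApprox t).pow 2)

/-- The first moment `F = ∫ t Λ(dt)` of an estimator with finite second moments: its expectations
are those of `Λ`, and its variance is at most that of `Λ`. -/
theorem POVM.exists_firstMoment (Λ : POVM H) (ρ : StateSpace H)
    (hΛ : Integrable (fun t : ℝ => t ^ 2) (Λ.outcome ρ)) :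
    ∃ F : Op H, IsSelfAdjoint F ∧
      (∀ σ : StateSpace H, Λ.expectation σ = reTr ((σ : Op H) * F)) ∧
      ∀ σ : StateSpace H, reTr ((σ : Op H) * (F * F)) ≤ ∫ t, t ^ 2 ∂(Λ.outcome σ) := by
  have h2 : ∀ σ : StateSpace H, Integrable (fun t : ℝ => t ^ 2) (Λ.outcome σ) := fun σ => by
    obtain ⟨C, hC, hle⟩ := Λ.outcome_le_smul ρ σ
    exact (hΛ.smul_measure hC).mono_measure hle
  have h1 : ∀ σ : StateSpace H, Integrable (fun t : ℝ => t) (Λ.outcome σ) := fun σ =>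
    ((memLp_two_iff_integrable_sq measurable_id.aestronglyMeasurable).2 (h2 σ)).integrable
      one_le_two
  have hlim : Tendsto (fun k (σ : StateSpace H) =>
      reTr ((σ : Op H) * Λ.simpleIntegral (simpleApprox k))) atTop
      (𝓝 fun σ : StateSpace H => Λ.expectation σ) := by
    refine tendsto_pi_nhds.2 fun σ => ?_
    simp only [← Λ.integral_simpleFunc σ]
    exact tendsto_integral_simpleApprox (h1 σ)
  -- F is found without operator-valued integration: the expectation functions of Hermitian
  -- operators form a finite-dimensional, hence closed, subspace of all functions of the state, and
  -- Λ's expectation is a pointwise limit of such functions.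
  have hcl : IsClosed ((LinearMap.range (stateExpectation H) : Submodule ℝ _) :
      Set (StateSpace H → ℝ)) := Submodule.closed_of_finiteDimensional _
  obtain ⟨⟨F, hFs⟩, hF⟩ := hcl.mem_of_tendsto hlim (Eventually.of_forall fun k =>
    ⟨⟨_, Λ.isSelfAdjoint_simpleIntegral (simpleApprox k)⟩, rfl⟩)
  have hF' : ∀ σ : StateSpace H, Λ.expectation σ = reTr ((σ : Op H) * F) := fun σ =>
    (congrFun hF σ).symm
  refine ⟨F, hFs, hF', fun σ => ?_⟩
  -- Convergence is needed against σ ∘ F, which is Hermitian but in general not a state.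
  have hA : ∀ A : Op H, IsSelfAdjoint A →
      Tendsto (fun k => reTr (A * Λ.simpleIntegral (simpleApprox k))) atTop
        (𝓝 (reTr (A * F))) := fun A hA => by
    obtain ⟨a, b, τ, rfl⟩ := exists_eq_smul_add_smul σ.2 hA
    have h3 := ((tendsto_pi_nhds.1 hlim σ).const_mul a).add
      ((tendsto_pi_nhds.1 hlim τ).const_mul b)
    rw [hF', hF'] at h3
    simpa only [add_mul, smul_mul_assoc, map_add, map_smul, smul_eq_mul] using h3
  have h4 := ((tendsto_integral_simpleApprox_sq (h2 σ)).sub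
    ((hA _ (isSelfAdjoint_jordan σ.2.1 hFs)).const_mul 2)).add_const (reTr ((σ : Op H) * (F * F)))
  have h5 := ge_of_tendsto h4
    (Eventually.of_forall fun k => Λ.simpleIntegral_sq_nonneg σ (simpleApprox k) hFs)
  -- With G = F the cross term becomes -2 Tr(σF²), so -Tr(σF²) remains after adding Tr(σG²).
  rw [jordan_comm, reTr_jordan_mul, jordan_apply, ← two_smul ℝ ((F : Op H) * F), smul_smul] at h5
  norm_num at h5
  linarith

end FirstMoment

/-! ### Finitely supported POVMs and spectral measures -/

section SpectralMeasure

open MeasureTheory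

variable {H : Type*} [NormedAddCommGroup H] [InnerProductSpace ℂ H] [FiniteDimensional ℂ H]

section Discrete

variable {κ : Type*} [Fintype κ]

/-- The estimator with the values `x i`, taken with the effects `P i`. -/
def POVM.discrete (P : κ → Op H) (x : κ → ℝ) (hP : ∀ i, (P i).IsPositive) (h1 : ∑ i, P i = 1) :
    POVM H where
  effect := ∑ i, VectorMeasure.dirac (x i) (P i)
  isPositive s := by
    classical
    rw [FunLike.coe_sum, Finset.sum_apply]
    refine Finset.sum_induction _ (fun A : Op H => A.IsPositive) (fun _ _ => .add)
      ContinuousLinearMap.isPositive_zero fun i _ => ?_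
    -- Positivity is required on every set; a Dirac vector measure takes the value 0 on
    -- non-measurable ones.
    change (if MeasurableSet s ∧ x i ∈ s then P i else 0).IsPositive
    split_ifs
    · exact hP i
    · exact ContinuousLinearMap.isPositive_zero
  effect_univ := by simp [h1]

variable {P : κ → Op H} {x : κ → ℝ} {hP : ∀ i, (P i).IsPositive} {h1 : ∑ i, P i = 1}

theorem POVM.discrete_outcome (σ : StateSpace H) :
    (POVM.discrete P x hP h1).outcome σ =
      ∑ i, ENNReal.ofReal (reTr ((σ : Op H) * P i)) • Measure.dirac (x i) := by
  ext s hs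
  rw [POVM.outcome_apply _ _ hs, POVM.discrete, FunLike.coe_sum, Finset.sum_apply, Finset.mul_sum,
    map_sum, ENNReal.ofReal_sum_of_nonneg, Measure.finsetSum_apply]
  · refine Finset.sum_congr rfl fun i _ => ?_
    rw [Measure.smul_apply, Measure.dirac_apply' _ hs, smul_eq_mul]
    by_cases h : x i ∈ s
    · rw [VectorMeasure.dirac_apply_of_mem hs h]
      simp [h]
    · rw [VectorMeasure.dirac_apply_of_notMem h]
      simp [h]
  · intro i _
    by_cases h : x i ∈ s
    · rw [VectorMeasure.dirac_apply_of_mem hs h]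
      exact reTr_mul_nonneg σ.2 (hP i)
    · rw [VectorMeasure.dirac_apply_of_notMem h]
      simp

theorem POVM.discrete_integrable (σ : StateSpace H) (g : ℝ → ℝ) :
    Integrable g ((POVM.discrete P x hP h1).outcome σ) := by
  rw [POVM.discrete_outcome]
  exact integrable_finsetSum_measure.2 fun i _ =>
    (integrable_dirac (by simp)).smul_measure ENNReal.ofReal_ne_top

theorem POVM.discrete_integral (σ : StateSpace H) (g : ℝ → ℝ) :
    ∫ t, g t ∂((POVM.discrete P x hP h1).outcome σ) =
      reTr ((σ : Op H) * ∑ i, g (x i) • P i) := by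
  rw [POVM.discrete_outcome, integral_finsetSum_measure fun i _ =>
    (integrable_dirac (by simp)).smul_measure ENNReal.ofReal_ne_top, Finset.mul_sum, map_sum]
  refine Finset.sum_congr rfl fun i _ => ?_
  rw [integral_smul_measure, integral_dirac, ENNReal.toReal_ofReal (reTr_mul_nonneg σ.2 (hP i)),
    mul_smul_comm, map_smul, smul_eq_mul, smul_eq_mul, mul_comm]

end Discrete

/-- The spectral measure of a Hermitian operator: an estimator whose expectation and mean squared
error are those of the operator. -/
theorem exists_spectral_POVM {F : Op H} (hF : IsSelfAdjoint F) :
    ∃ Λ : POVM H, ∀ σ : StateSpace H, Integrable (fun t : ℝ => t) (Λ.outcome σ) ∧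
      Λ.expectation σ = reTr ((σ : Op H) * F) ∧ ∀ c : ℝ, Λ.meanSquaredError σ c =
        ENNReal.ofReal (reTr ((σ : Op H) * ((F - c • 1) * (F - c • 1)))) := by
  have hs := ContinuousLinearMap.isSelfAdjoint_iff_isSymmetric.1 hF
  let b := hs.eigenvectorBasis rfl
  let x := hs.eigenvalues rfl
  let P : Fin (Module.finrank ℂ H) → Op H := fun i => InnerProductSpace.rankOne ℂ (b i) (b i)
  have h1 : ∑ i, P i = 1 := b.sum_rankOne_eq_id
  have hFP : ∀ i, F * P i = x i • P i := fun i => by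
    ext y
    have h := hs.apply_eigenvectorBasis rfl i
    have h' : F (b i) = (x i : ℂ) • b i := h
    rw [mul_apply_eq_comp, smul_apply, InnerProductSpace.rankOne_apply,
      map_smul, h', smul_comm, Complex.coe_smul]
  have hF1 : ∑ i, x i • P i = F := by
    rw [← Finset.sum_congr rfl fun i _ => hFP i, ← Finset.mul_sum, h1, mul_one]
  have hF2 : ∀ c : ℝ, ∑ i, (x i - c) ^ 2 • P i = (F - c • 1) * (F - c • 1) := fun c => by
    have e : ∀ i, (F - c • 1) * P i = (x i - c) • P i := fun i => by
      rw [sub_mul, hFP, smul_mul_assoc, one_mul, sub_smul]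
    -- F - c acts on the range of P i as the scalar x i - c, so the squares follow without
    -- orthogonality of the P i; summation uses ΣP i = 1.
    have e2 : ∀ i, (x i - c) ^ 2 • P i = (F - c • 1) * (F - c • 1) * P i := fun i => by
      rw [mul_assoc, e, mul_smul_comm, e, smul_smul, sq]
    rw [Finset.sum_congr rfl fun i _ => e2 i, ← Finset.mul_sum, h1, mul_one]
  refine ⟨POVM.discrete P x (fun i => InnerProductSpace.isPositive_rankOne_self _) h1,
    fun σ => ⟨POVM.discrete_integrable σ _, ?_, fun c => ?_⟩⟩
  · rw [POVM.expectation, POVM.discrete_integral, hF1]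
  · rw [POVM.meanSquaredError, ← ofReal_integral_eq_lintegral_ofReal
      (POVM.discrete_integrable σ _) (ae_of_all _ fun t => sq_nonneg _),
      POVM.discrete_integral, hF2]

end SpectralMeasure

/-! ### Efficient estimators and the spans K_p -/

section EfficientEstimators

open MeasureTheory

variable {H : Type*} [NormedAddCommGroup H] [InnerProductSpace ℂ H] [FiniteDimensional ℂ H]
variable {n : ℕ} {M : Type*} [TopologicalSpace M] [ChartedSpace (EuclideanSpace ℝ (Fin n)) M]

theorem sldMetric_comm {ρ A B : Op H} (hρ : ρ ∈ StateSpace H) (hA : IsSelfAdjoint A)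
    (hB : IsSelfAdjoint B) : sldMetric ρ A B = sldMetric ρ B A := by
  rw [sldMetric_eq hρ hA hB, sldMetric_eq hρ hB hA, reTr_mul_sld hρ, reTr_mul_comm]

theorem reTr_mul_smul_one (A : Op H) (c : ℝ) : reTr (A * c • 1) = c * reTr A := by
  rw [mul_smul_comm, mul_one, map_smul, smul_eq_mul]

theorem reTr_push {ι : M → StateSpace H} (hι : IsSubmanifold n ι) (p : M)
    (v : TangentSpace (𝓡 n) p) : reTr (push ι p v) = 0 := by
  rw [reTr_apply, (hι.push_mem p v).2, Complex.zero_re]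

/-- The differential of the inclusion map. -/
def pushL (ι : M → StateSpace H) (p : M) : TangentSpace (𝓡 n) p →L[ℝ] Op H :=
  mfderiv (𝓡 n) 𝓘(ℝ, Op H) (fun q => (ι q : Op H)) p

/-- The map `(c, v) ↦ c + L_v` from `ℝ × T_p M` to the Hermitian operators. -/
def sldFrame (ι : M → StateSpace H) (p : M) : (ℝ × TangentSpace (𝓡 n) p) →ₗ[ℝ] Op H :=
  (LinearMap.toSpanSingleton ℝ (Op H) 1).coprod
    ((Ring.inverse (jordan (ι p : Op H)) : Op H →L[ℝ] Op H).toLinearMap ∘ₗ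
      (pushL ι p).toLinearMap)

theorem sldFrame_apply (ι : M → StateSpace H) (p : M) (c : ℝ) (v : TangentSpace (𝓡 n) p) :
    sldFrame ι p (c, v) = c • 1 + sld (ι p) (push ι p v) := rfl

variable (n) in
/-- The space spanned by the identity and the symmetric logarithmic derivatives at `p`. -/
def sldSpan (ι : M → StateSpace H) (p : M) : Submodule ℝ (Op H) :=
  LinearMap.range (sldFrame (n := n) ι p)

theorem mem_sldSpan {ι : M → StateSpace H} {p : M} {F : Op H} :
    F ∈ sldSpan n ι p ↔
      ∃ (c : ℝ) (v : TangentSpace (𝓡 n) p), c • 1 + sld (ι p) (push ι p v) = F :=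
  ⟨fun ⟨⟨c, v⟩, h⟩ => ⟨c, v, h⟩, fun ⟨c, v, h⟩ => ⟨(c, v), h⟩⟩

theorem reTr_mul_sldFrame {ι : M → StateSpace H} (hι : IsSubmanifold n ι) (p : M) (c : ℝ)
    (v : TangentSpace (𝓡 n) p) :
    reTr ((ι p : Op H) * (c • 1 + sld (ι p) (push ι p v))) = c := by
  rw [mul_add, map_add, reTr_mul_smul_one, reTr_state,
    reTr_mul_sld_of_tangent (ι p).2 (hι.push_mem p v), mul_one, add_zero]

theorem reTr_push_mul_sldFrame {ι : M → StateSpace H} (hι : IsSubmanifold n ι) (p : M) (c : ℝ)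
    (v w : TangentSpace (𝓡 n) p) :
    reTr (push ι p w * (c • 1 + sld (ι p) (push ι p v))) =
      sldMetric (ι p) (push ι p v) (push ι p w) := by
  rw [mul_add, map_add, reTr_mul_smul_one, reTr_push hι, mul_zero, zero_add,
    sldMetric_comm (ι p).2 (hι.push_mem p v).1 (hι.push_mem p w).1,
    sldMetric_eq (ι p).2 (hι.push_mem p w).1 (hι.push_mem p v).1]

theorem push_eq_zero {ι : M → StateSpace H} (hι : IsSubmanifold n ι) {p : M}
    {v : TangentSpace (𝓡 n) p} (h : sldMetric (ι p) (push ι p v) (push ι p v) = 0) : v = 0 :=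
  hι.immersion p ((sldMetric_self_pos (ι p).2 (hι.push_mem p v) h.le).trans
    (map_zero (pushL ι p)).symm)

/-- Tracing c + L_v against ι p kills L_v and returns c; tracing it against the tangent vector of v
kills the scalar and returns g(v, v), which is definite. -/
theorem sldFrame_injective {ι : M → StateSpace H} (hι : IsSubmanifold n ι) (p : M) :
    Function.Injective (sldFrame (n := n) ι p) := by
  rw [← LinearMap.ker_eq_bot, LinearMap.ker_eq_bot']
  rintro ⟨c, v⟩ h
  rw [sldFrame_apply] at h
  have h1 := reTr_mul_sldFrame hι p c v
  have h2 := reTr_push_mul_sldFrame hι p c v v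
  rw [h, mul_zero, map_zero] at h1 h2
  rw [← h1, push_eq_zero hι h2.symm]
  rfl

theorem finrank_sldSpan {ι : M → StateSpace H} (hι : IsSubmanifold n ι) (p : M) :
    Module.finrank ℝ (sldSpan n ι p) = n + 1 := by
  have : FiniteDimensional ℝ (TangentSpace (𝓡 n) p) :=
    inferInstanceAs (FiniteDimensional ℝ (EuclideanSpace ℝ (Fin n)))
  have h : Module.finrank ℝ (TangentSpace (𝓡 n) p) = n :=
    finrank_euclideanSpace_fin (𝕜 := ℝ) (n := n)
  rw [sldSpan, LinearMap.finrank_range_of_inj (sldFrame_injective hι p), Module.finrank_prod,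
    Module.finrank_self, h, add_comm]

theorem isSelfAdjoint_of_mem_sldSpan {ι : M → StateSpace H} (hι : IsSubmanifold n ι) {p : M}
    {F : Op H} (hF : F ∈ sldSpan n ι p) : IsSelfAdjoint F := by
  obtain ⟨c, v, rfl⟩ := mem_sldSpan.1 hF
  refine IsSelfAdjoint.add ?_ (isSelfAdjoint_sld (ι p).2 (hι.push_mem p v).1)
  rw [IsSelfAdjoint, star_smul, star_one, star_trivial c]

/-- The linear functional `A ↦ Tr (A F)`. -/
def expectL (F : Op H) : Op H →L[ℝ] ℝ := reTr.comp ((ContinuousLinearMap.mul ℝ (Op H)).flip F)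

theorem hasMFDerivAt_expectation {ι : M → StateSpace H} (hι : IsSubmanifold n ι) (F : Op H)
    (p : M) : HasMFDerivAt (𝓡 n) 𝓘(ℝ, ℝ) (fun q => reTr ((ι q : Op H) * F)) p
      ((expectL F).comp (pushL ι p)) := by
  have h : HasMFDerivAt (𝓡 n) 𝓘(ℝ, Op H) (fun q => (ι q : Op H)) p (pushL ι p) :=
    (hι.contMDiff.mdifferentiableAt (by simp)).hasMFDerivAt
  exact (expectL F).hasMFDerivAt.comp p h

theorem mfderiv_expectation_apply {ι : M → StateSpace H} (hι : IsSubmanifold n ι) {F : Op H}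
    {f : M → ℝ} (hf : ∀ q, f q = reTr ((ι q : Op H) * F)) (p : M) (w : TangentSpace (𝓡 n) p) :
    (mfderiv (𝓡 n) 𝓘(ℝ, ℝ) f p : TangentSpace (𝓡 n) p →L[ℝ] ℝ) w = reTr (push ι p w * F) := by
  have h := hasMFDerivAt_expectation hι F p
  rw [← funext hf] at h
  rw [h.mfderiv]
  rfl

theorem cotangentNormSq_eq {ι : M → StateSpace H} (hι : IsSubmanifold n ι) {p : M}
    {α : TangentSpace (𝓡 n) p →L[ℝ] ℝ} {v : TangentSpace (𝓡 n) p}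
    (h : ∀ w, α w = sldMetric (ι p) (push ι p v) (push ι p w)) :
    cotangentNormSq ι p α =
      reTr ((ι p : Op H) * (sld (ι p) (push ι p v) * sld (ι p) (push ι p v))) := by
  rw [cotangentNormSq, ← (gradVec_spec hι p α v).1 h, sldMetric, symInner, mul_assoc]

theorem cotangentNormSq_nonneg {ι : M → StateSpace H} (hι : IsSubmanifold n ι) {p : M}
    (α : TangentSpace (𝓡 n) p →L[ℝ] ℝ) : 0 ≤ cotangentNormSq ι p α := by
  have hL := isSelfAdjoint_sld (ι p).2 (hι.push_mem p (gradVec ι p α)).1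
  have h := reTr_star_mul_mul_nonneg (ι p).2 (sld (ι p) (push ι p (gradVec ι p α)))
  rwa [hL.star_eq, reTr_mul_comm] at h

/-- The expectation function of an operator that lies in the span of `1` and the symmetric
logarithmic derivatives at all points of `M` has an efficient estimator. -/
theorem mem_efficientFunctions_of_mem_sldSpan {ι : M → StateSpace H} (hι : IsSubmanifold n ι)
    [Nonempty M] {F : Op H} (hF : ∀ p, F ∈ sldSpan n ι p) {f : C^∞⟮𝓡 n, M; ℝ⟯}
    (hf : ∀ p, f p = reTr ((ι p : Op H) * F)) : f ∈ efficientFunctions ι := by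
  obtain ⟨Λ, hΛ⟩ := exists_spectral_POVM
    (isSelfAdjoint_of_mem_sldSpan hι (hF (Classical.arbitrary M)))
  refine ⟨Λ, fun p => ⟨⟨(hΛ (ι p)).1, by rw [(hΛ (ι p)).2.1, hf], ?_⟩, ?_⟩⟩
  · have h1 : (fun q => Λ.expectation (ι q)) = f := by
      funext q
      rw [(hΛ (ι q)).2.1, hf]
    rw [h1]
    exact (f.contMDiff.mdifferentiableAt (by simp)).hasMFDerivAt
  · obtain ⟨c, v, hcv⟩ := mem_sldSpan.1 (hF p)
    have hc : f p = c := by rw [hf, ← hcv, reTr_mul_sldFrame hι]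
    -- So the variance of F at p is g(v, v), and pairing F with tangent vectors shows that v is the
    -- gradient of f.
    have hL : F - f p • 1 = sld (ι p) (push ι p v) := by rw [← hcv, hc, add_sub_cancel_left]
    rw [(hΛ (ι p)).2.2, hL]
    refine congrArg ENNReal.ofReal (cotangentNormSq_eq hι fun w => ?_).symm
    refine (mfderiv_expectation_apply hι hf p w).trans ?_
    rw [← hcv, reTr_push_mul_sldFrame hι]

/-- Constants are square integrable for a finite measure, so a finite second moment about c is one
about 0. This turns the possibly infinite mean squared error into ordinary integrals. -/
theorem integrable_sq_of_lintegral_ne_top {μ : Measure ℝ} [IsFiniteMeasure μ] {c : ℝ}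
    (h : ∫⁻ t, ENNReal.ofReal ((t - c) ^ 2) ∂μ ≠ ⊤) :
    Integrable (fun t : ℝ => (t - c) ^ 2) μ ∧ Integrable (fun t : ℝ => t ^ 2) μ := by
  have hm : Measurable fun t : ℝ => t - c := measurable_id.sub_const c
  have h1 : Integrable (fun t : ℝ => (t - c) ^ 2) μ :=
    (lintegral_ofReal_ne_top_iff_integrable (hm.pow_const 2).aestronglyMeasurable
      (ae_of_all _ fun t => sq_nonneg _)).1 h
  have h2 := ((memLp_two_iff_integrable_sq hm.aestronglyMeasurable).2 h1).add
    (memLp_const (μ := μ) c)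
  have e : (fun t : ℝ => t - c) + (fun _ => c) = id := by
    funext t
    simp
  rw [e] at h2
  exact ⟨h1, (memLp_two_iff_integrable_sq measurable_id.aestronglyMeasurable).1 h2⟩

/-- The equality case of the quantum Cramér–Rao inequality. -/
theorem mem_sldSpan_of_variance_le {ι : M → StateSpace H} (hι : IsSubmanifold n ι) {F : Op H}
    (hF : IsSelfAdjoint F) {p : M} (c : ℝ) {α : TangentSpace (𝓡 n) p →L[ℝ] ℝ}
    (hα : ∀ w, α w = reTr (push ι p w * F))
    (h : reTr ((ι p : Op H) * ((F - c • 1) * (F - c • 1))) ≤ cotangentNormSq ι p α) :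
    F ∈ sldSpan n ι p := by
  set v := gradVec ι p α with hv
  have hvw := (gradVec_spec hι p α v).2 rfl
  have hL := isSelfAdjoint_sld (ι p).2 (hι.push_mem p v).1
  have hG : IsSelfAdjoint (F - c • 1) := by
    refine hF.sub ?_
    rw [IsSelfAdjoint, star_smul, star_one, star_trivial c]
  have hN : cotangentNormSq ι p α = reTr (push ι p v * sld (ι p) (push ι p v)) := by
    rw [cotangentNormSq, ← hv, sldMetric_eq (ι p).2 (hι.push_mem p v).1 (hι.push_mem p v).1]
  have hc : reTr (push ι p v * (F - c • 1)) = reTr (push ι p v * sld (ι p) (push ι p v)) := by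
    rw [mul_sub, map_sub, reTr_mul_smul_one, reTr_push hι, mul_zero, sub_zero, ← hα, hvw,
      ← hN]
    rfl
  refine mem_sldSpan.2 ⟨c, v, ?_⟩
  have hR := hG.sub hL
  -- With G = F - c and L = L_v, v the gradient, both Tr(ρ(G ∘ L)) and Tr(ρL²) equal ‖α‖². Hence
  -- Tr(ρ(G - L)²) = Tr(ρG²) - ‖α‖² ≤ 0, and faithfulness of ρ gives G = L.
  have h0 : F - c • 1 - sld (ι p) (push ι p v) = 0 := by
    refine eq_zero_of_reTr (ι p).2 _ ?_
    set G := F - c • 1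
    set L := sld (ι p) (push ι p v)
    have e1 : reTr ((ι p : Op H) * (G * L)) + reTr ((ι p : Op H) * (L * G)) =
        2 * reTr (push ι p v * G) := by
      have : (ι p : Op H) * (G * L) + (ι p : Op H) * (L * G) =
          (2 : ℝ) • ((ι p : Op H) * jordan L G) := by
        rw [jordan_apply, mul_smul_comm, smul_smul, mul_add]
        norm_num [add_comm]
      rw [← map_add, this, map_smul, ← reTr_jordan_mul, jordan_comm, jordan_sld (ι p).2,
        smul_eq_mul]
    have e2 : reTr ((ι p : Op H) * (L * L)) = reTr (push ι p v * L) := by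
      rw [← mul_assoc]
      change symInner _ _ _ = _
      rw [symInner_eq (ι p).2 hL hL, jordan_sld (ι p).2]
    have e3 : (ι p : Op H) * ((G - L) * (G - L)) = (ι p : Op H) * (G * G) -
        ((ι p : Op H) * (G * L) + (ι p : Op H) * (L * G)) + (ι p : Op H) * (L * L) := by
      noncomm_ring
    rw [hR.star_eq, reTr_mul_comm, mul_assoc, e3, map_add, map_sub, map_add]
    linarith
  rw [← sub_eq_zero.1 h0, add_sub_cancel]

/-- A function with an efficient estimator is the expectation function of an operator that lies in
the span of `1` and the symmetric logarithmic derivatives at all points of `M`. -/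
theorem exists_of_mem_efficientFunctions {ι : M → StateSpace H} (hι : IsSubmanifold n ι)
    [Nonempty M] {f : C^∞⟮𝓡 n, M; ℝ⟯} (hf : f ∈ efficientFunctions ι) :
    ∃ F : Op H, (∀ p, F ∈ sldSpan n ι p) ∧ ∀ p, f p = reTr ((ι p : Op H) * F) := by
  obtain ⟨Λ, hΛ⟩ := hf
  have hfin : ∀ p, ∫⁻ t, ENNReal.ofReal ((t - f p) ^ 2) ∂(Λ.outcome (ι p)) ≠ ⊤ := fun p =>
    (hΛ p).2.trans_ne ENNReal.ofReal_ne_top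
  -- A finite second moment at one point suffices, because the outcome distributions in different
  -- states bound each other. The same F then serves all of M.
  obtain ⟨F, hF, hE, hV⟩ := Λ.exists_firstMoment (ι (Classical.arbitrary M))
    (integrable_sq_of_lintegral_ne_top (hfin _)).2
  have hfF : ∀ p, f p = reTr ((ι p : Op H) * F) := fun p => by rw [← hE, (hΛ p).1.2.1]
  refine ⟨F, fun p => mem_sldSpan_of_variance_le hι hF (f p)
    (mfderiv_expectation_apply hι hfF p) ?_, hfF⟩
  obtain ⟨hi, hi2⟩ := integrable_sq_of_lintegral_ne_top (hfin p)
  have h1 : ∫ t, (t - f p) ^ 2 ∂(Λ.outcome (ι p)) =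
      cotangentNormSq ι p (mfderiv (𝓡 n) 𝓘(ℝ, ℝ) f p) := by
    have h := (hΛ p).2
    rw [POVM.meanSquaredError, ← ofReal_integral_eq_lintegral_ofReal hi
      (ae_of_all _ fun t => sq_nonneg _)] at h
    exact (ENNReal.ofReal_eq_ofReal_iff (integral_nonneg fun t => sq_nonneg _)
      (cotangentNormSq_nonneg hι _)).1 h
  have h2 : ∫ t, (t - f p) ^ 2 ∂(Λ.outcome (ι p)) =
      ∫ t, t ^ 2 ∂(Λ.outcome (ι p)) - 2 * f p * f p + f p ^ 2 := by
    have h3 : (fun t : ℝ => (t - f p) ^ 2) = fun t => t ^ 2 - 2 * f p * t + f p ^ 2 := by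
      funext t
      ring
    have h4 : Integrable (fun t : ℝ => t) (Λ.outcome (ι p)) := (hΛ p).1.1
    rw [h3, integral_add (f := fun t : ℝ => t ^ 2 - 2 * f p * t) (hi2.sub (h4.const_mul _))
      (integrable_const _),
      integral_sub hi2 (h4.const_mul _), integral_const_mul]
    have h5 : ∫ t, t ∂(Λ.outcome (ι p)) = f p := (hΛ p).1.2.1
    rw [h5]
    simp
  -- Λ and F have the same mean f(p), so their variances differ exactly as their second moments do.
  have h6 : reTr ((ι p : Op H) * ((F - f p • 1) * (F - f p • 1))) =
      reTr ((ι p : Op H) * (F * F)) - 2 * f p * f p + f p ^ 2 := by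
    have e : (F - f p • 1) * (F - f p • 1) = F * F - (2 * f p) • F + f p ^ 2 • 1 := by
      simp only [sub_mul, mul_sub, smul_mul_assoc, mul_smul_comm, one_mul, mul_one]
      module
    rw [e, mul_add, mul_sub, mul_smul_comm, map_add, map_sub, map_smul, reTr_mul_smul_one,
      reTr_state, ← hfF, smul_eq_mul, mul_one]
  rw [← h1, h2, h6]
  linarith [hV (ι p)]

end EfficientEstimators

/-! ### Families of subspaces with constant range, and chart coordinates -/

section ConstantSpans

open Filter Topology

section Calculus

variable {E G F : Type*} [NormedAddCommGroup E] [NormedSpace ℝ E] [NormedAddCommGroup G]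
  [NormedSpace ℝ G] [FiniteDimensional ℝ G] [NormedAddCommGroup F] [NormedSpace ℝ F]
  [FiniteDimensional ℝ F]

omit [FiniteDimensional ℝ G] in
theorem exists_leftInverse_of_injective {T : G →L[ℝ] F} (hT : Function.Injective T) :
    ∃ R : F →L[ℝ] G, R.comp T = ContinuousLinearMap.id ℝ G := by
  obtain ⟨R, hR⟩ := (T : G →ₗ[ℝ] F).exists_leftInverse_of_injective (LinearMap.ker_eq_bot.2 hT)
  exact ⟨LinearMap.toContinuousLinearMap R,
    ContinuousLinearMap.ext fun g => LinearMap.congr_fun hR g⟩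

-- Composition with a fixed left inverse R of T x₀ yields endomorphisms of G near the identity.
-- Inverting them gives left inverses of T x that depend on x as regularly as T does.
omit [FiniteDimensional ℝ F] in
theorem eventually_isUnit_comp {X : Type*} [TopologicalSpace X] {T : X → G →L[ℝ] F} {x₀ : X}
    {R : F →L[ℝ] G} (hR : R.comp (T x₀) = ContinuousLinearMap.id ℝ G)
    (hT : ContinuousAt T x₀) : ∀ᶠ x in 𝓝 x₀, IsUnit (R.comp (T x)) := by
  have hc : ContinuousAt (fun x => R.comp (T x)) x₀ := continuousAt_const.clm_comp hT
  refine hc.eventually (Units.isOpen.mem_nhds ?_)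
  change IsUnit (R.comp (T x₀))
  rw [hR]
  exact isUnit_one

/-- If the derivatives of a family of injective linear maps take their values in the ranges of the
maps of the family, then these ranges do not vary. -/
theorem eventually_range_eq {T : E → G →L[ℝ] F} {x₀ : E}
    (hT : ∀ᶠ x in 𝓝 x₀, DifferentiableAt ℝ T x) (hinj : Function.Injective (T x₀))
    (h : ∀ᶠ x in 𝓝 x₀, ∀ e g, ∃ k, fderiv ℝ T x e g = T x k) :
    ∀ᶠ x in 𝓝 x₀, Set.range (T x) = Set.range (T x₀) := by
  obtain ⟨R, hR⟩ := exists_leftInverse_of_injective hinj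
  have hu := eventually_isUnit_comp hR hT.self_of_nhds.continuousAt
  obtain ⟨r, hr, hball⟩ := Metric.eventually_nhds_iff_ball.1 (hT.and (hu.and h))
  -- The family S has the ranges of T but is normalized by R S = id. With a = R T, its derivative is
  -- dT a⁻¹ - T a⁻¹ R dT a⁻¹; where dT a⁻¹ g = T k this equals T k - T a⁻¹ (R T) k = 0.
  let S : E → G →L[ℝ] F := fun x => (T x).comp (Ring.inverse (R.comp (T x)))
  have hS : ∀ x ∈ Metric.ball x₀ r, HasFDerivAt S (0 : E →L[ℝ] G →L[ℝ] F) x := by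
    intro x hx
    obtain ⟨hd, ⟨a, ha⟩, hk⟩ := hball x hx
    have h1 : HasFDerivAt (fun y => R.comp (T y))
        ((ContinuousLinearMap.compL ℝ G F G R).comp (fderiv ℝ T x)) x :=
      (ContinuousLinearMap.compL ℝ G F G R).hasFDerivAt.comp x hd.hasFDerivAt
    have h2 := hasFDerivAt_ringInverse (𝕜 := ℝ) (R := G →L[ℝ] G) a
    rw [ha] at h2
    have h3 := hd.hasFDerivAt.clm_comp (h2.comp x h1)
    refine h3.congr_fderiv ?_
    ext e g
    obtain ⟨k, hk⟩ := hk e ((↑a⁻¹ : G →L[ℝ] G) g)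
    have h4 : Ring.inverse (R.comp (T x)) = (↑a⁻¹ : G →L[ℝ] G) := by
      rw [← ha, Ring.inverse_unit]
    have h5 : (↑a⁻¹ : G →L[ℝ] G) (R (T x k)) = k := by
      have h6 := a.inv_mul
      rw [ha] at h6
      exact congrArg (fun A : G →L[ℝ] G => A k) h6
    simp [h4, hk, h5]
  have hconst : ∀ x ∈ Metric.ball x₀ r, S x = S x₀ := fun x hx =>
    (convex_ball x₀ r).is_const_of_fderivWithin_eq_zero (𝕜 := ℝ)
      (fun y hy => (hS y hy).differentiableAt.differentiableWithinAt)
      (fun y hy => by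
        rw [fderivWithin_of_isOpen Metric.isOpen_ball hy, (hS y hy).fderiv]) hx
      (Metric.mem_ball_self hr)
  have hrange : ∀ x ∈ Metric.ball x₀ r, Set.range (T x) = Set.range (S x) := by
    intro x hx
    obtain ⟨-, ⟨a, ha⟩, -⟩ := hball x hx
    have h4 : Ring.inverse (R.comp (T x)) = (↑a⁻¹ : G →L[ℝ] G) := by
      rw [← ha, Ring.inverse_unit]
    have h5 : Function.Surjective (↑a⁻¹ : G →L[ℝ] G) := fun g =>
      ⟨(a : G →L[ℝ] G) g, congrArg (fun A : G →L[ℝ] G => A g) a.inv_mul⟩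
    simp only [S, h4]
    exact (h5.range_comp (T x)).symm
  filter_upwards [Metric.ball_mem_nhds x₀ hr] with x hx
  rw [hrange x hx, hconst x hx, hrange x₀ (Metric.mem_ball_self hr)]

end Calculus

section Chart

variable {n : ℕ} {M : Type*} [TopologicalSpace M] [ChartedSpace (EuclideanSpace ℝ (Fin n)) M]
  [IsManifold (𝓡 n) ∞ M]
variable {V : Type*} [NormedAddCommGroup V] [NormedSpace ℝ V]

/-- The components of a tangent vector at `q` in the chart around `p`. -/
def coord (p q : M) : TangentSpace (𝓡 n) q →L[ℝ] EuclideanSpace ℝ (Fin n) :=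
  mfderiv (𝓡 n) 𝓘(ℝ, EuclideanSpace ℝ (Fin n)) (extChartAt (𝓡 n) p) q

theorem coord_eq {p q : M} (hq : q ∈ (extChartAt (𝓡 n) p).source) (v : TangentSpace (𝓡 n) q) :
    (trivializationAt (EuclideanSpace ℝ (Fin n)) (TangentSpace (𝓡 n)) p ⟨q, v⟩).2 =
      coord p q v := by
  have hq' : q ∈ (chartAt (EuclideanSpace ℝ (Fin n)) p).source := by
    rwa [extChartAt_source] at hq
  have h := TangentBundle.continuousLinearMapAt_trivializationAt (I := 𝓡 n) hq'
  rw [coord, ← h, Bundle.Trivialization.continuousLinearMapAt_apply,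
    Bundle.Trivialization.linearMapAt_apply, if_pos]
  exact hq'

theorem coord_symm {p q : M} (hq : q ∈ (extChartAt (𝓡 n) p).source)
    (e : EuclideanSpace ℝ (Fin n)) :
    coord p q ((trivializationAt (EuclideanSpace ℝ (Fin n)) (TangentSpace (𝓡 n)) p).symm q e) =
      e := by
  rw [← coord_eq hq]
  have hq' : q ∈ (chartAt (EuclideanSpace ℝ (Fin n)) p).source := by
    rwa [extChartAt_source] at hq
  rw [Bundle.Trivialization.apply_mk_symm _ hq']

/-- Near p the tangent bundle is trivialized by the chart at p, so smoothness of a field reduces to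
that of a Euclidean-valued function. -/
theorem contMDiffAt_field_iff {X : ∀ p : M, TangentSpace (𝓡 n) p} {p : M} :
    ContMDiffAt (𝓡 n) (𝓡 n).tangent ∞ (fun q => (⟨q, X q⟩ : TangentBundle (𝓡 n) M)) p ↔
      ContMDiffAt (𝓡 n) 𝓘(ℝ, EuclideanSpace ℝ (Fin n)) ∞ (fun q => coord p q (X q)) p := by
  refine (Bundle.contMDiffAt_section (IB := 𝓡 n) (F := EuclideanSpace ℝ (Fin n))
    (E := (TangentSpace (𝓡 n) : M → Type _)) (n := ∞) p).trans ?_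
  have h : (fun q => (trivializationAt (EuclideanSpace ℝ (Fin n)) (TangentSpace (𝓡 n)) p
      ⟨q, X q⟩).2) =ᶠ[𝓝 p] fun q => coord p q (X q) := by
    filter_upwards [extChartAt_source_mem_nhds (I := 𝓡 n) p] with q hq
    exact coord_eq hq _
  exact h.contMDiffAt_iff

theorem contDiffAt_comp_chart_symm {k : WithTop ℕ∞} (hk : k ≤ ∞) {Y : M → V} {p q : M}
    (hq : q ∈ (extChartAt (𝓡 n) p).source) (hY : ContMDiffAt (𝓡 n) 𝓘(ℝ, V) k Y q) :
    ContDiffAt ℝ k (Y ∘ (extChartAt (𝓡 n) p).symm) (extChartAt (𝓡 n) p q) := by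
  have hx := (extChartAt (𝓡 n) p).map_source hq
  have h1 := ((contMDiffOn_extChartAt_symm (I := 𝓡 n) (n := ∞) p).of_le hk).contMDiffAt
    ((isOpen_extChartAt_target p).mem_nhds hx)
  refine contMDiffAt_iff_contDiffAt.1 (ContMDiffAt.comp _ ?_ h1)
  rwa [(extChartAt (𝓡 n) p).left_inv hq]

theorem mfderiv_eq_fderiv_coord {Y : M → V} {p q : M}
    (hq : q ∈ (extChartAt (𝓡 n) p).source) (hY : ContMDiffAt (𝓡 n) 𝓘(ℝ, V) 1 Y q)
    (v : TangentSpace (𝓡 n) q) :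
    (mfderiv (𝓡 n) 𝓘(ℝ, V) Y q : TangentSpace (𝓡 n) q →L[ℝ] V) v =
      fderiv ℝ (Y ∘ (extChartAt (𝓡 n) p).symm) (extChartAt (𝓡 n) p q) (coord p q v) := by
  have h1 := ((contDiffAt_comp_chart_symm (by simp) hq hY).differentiableAt
    (by simp)).hasFDerivAt.hasMFDerivAt
  have hq' : q ∈ (chartAt (EuclideanSpace ℝ (Fin n)) p).source := by
    rwa [extChartAt_source] at hq
  have h2 := (mdifferentiableAt_extChartAt (I := 𝓡 n) hq').hasMFDerivAt
  have h3 := h1.comp q h2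
  have h4 : (Y ∘ (extChartAt (𝓡 n) p).symm) ∘ extChartAt (𝓡 n) p =ᶠ[𝓝 q] Y := by
    filter_upwards [extChartAt_source_mem_nhds' (I := 𝓡 n) hq] with r hr
    simp only [Function.comp_apply, (extChartAt (𝓡 n) p).left_inv hr]
  rw [(h3.congr_of_eventuallyEq h4.symm).mfderiv]
  rfl

end Chart

end ConstantSpans

/-! ### Smooth fields along M and the e-connection in terms of logarithmic derivatives -/

section SmoothFields

open Filter Topology

variable {H : Type*} [NormedAddCommGroup H] [InnerProductSpace ℂ H] [FiniteDimensional ℂ H]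
variable {n : ℕ} {M : Type*} [TopologicalSpace M] [ChartedSpace (EuclideanSpace ℝ (Fin n)) M]
  [IsManifold (𝓡 n) ∞ M]

omit [FiniteDimensional ℂ H] in
theorem dOp_eq {Y : M → Op H} {p q : M} (hq : q ∈ (extChartAt (𝓡 n) p).source)
    (hY : ContMDiffAt (𝓡 n) 𝓘(ℝ, Op H) ∞ Y q) (v : TangentSpace (𝓡 n) q) :
    dOp Y q v =
      fderiv ℝ (Y ∘ (extChartAt (𝓡 n) p).symm) (extChartAt (𝓡 n) p q) (coord p q v) :=
  mfderiv_eq_fderiv_coord hq (hY.of_le (by simp)) v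

omit [FiniteDimensional ℂ H] in
theorem contMDiffAt_fderiv_chart {Y : M → Op H} {p : M}
    (hY : ContMDiffAt (𝓡 n) 𝓘(ℝ, Op H) ∞ Y p) :
    ContMDiffAt (𝓡 n) 𝓘(ℝ, EuclideanSpace ℝ (Fin n) →L[ℝ] Op H) ∞ (fun q =>
      fderiv ℝ (Y ∘ (extChartAt (𝓡 n) p).symm) (extChartAt (𝓡 n) p q)) p := by
  have h1 := (contDiffAt_comp_chart_symm le_rfl (mem_extChartAt_source (I := 𝓡 n) p)
    hY).fderiv_right (m := ∞) (by simp)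
  exact h1.contMDiffAt.comp p contMDiffAt_extChartAt

omit [FiniteDimensional ℂ H] in
/-- The derivative of a smooth operator-valued function along a smooth vector field. -/
theorem contMDiff_dOp {Y : M → Op H} (hY : ContMDiff (𝓡 n) 𝓘(ℝ, Op H) ∞ Y)
    {X : ∀ p : M, TangentSpace (𝓡 n) p} (hX : IsSmoothField X) :
    ContMDiff (𝓡 n) 𝓘(ℝ, Op H) ∞ fun q => dOp Y q (X q) := fun p => by
  have h1 := (contMDiffAt_fderiv_chart (hY p)).clm_apply (contMDiffAt_field_iff.1 (hX p))
  refine h1.congr_of_eventuallyEq ?_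
  filter_upwards [extChartAt_source_mem_nhds (I := 𝓡 n) p] with q hq
  exact dOp_eq hq (hY q) _

/-- A field of tangent vectors of `M` whose image in the space of operators is smooth is smooth. -/
theorem isSmoothField_of_push {ι : M → StateSpace H} (hι : IsSubmanifold n ι)
    {W : ∀ p : M, TangentSpace (𝓡 n) p}
    (hW : ContMDiff (𝓡 n) 𝓘(ℝ, Op H) ∞ fun q => push ι q (W q)) : IsSmoothField W := fun p => by
  refine contMDiffAt_field_iff.2 ?_
  let T : M → EuclideanSpace ℝ (Fin n) →L[ℝ] Op H := fun q =>
    fderiv ℝ ((fun q => (ι q : Op H)) ∘ (extChartAt (𝓡 n) p).symm) (extChartAt (𝓡 n) p q)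
  have hT : ContMDiffAt (𝓡 n) 𝓘(ℝ, EuclideanSpace ℝ (Fin n) →L[ℝ] Op H) ∞ T p :=
    contMDiffAt_fderiv_chart (hι.contMDiff p)
  have hpush : ∀ q ∈ (extChartAt (𝓡 n) p).source, ∀ v, push ι q v = T q (coord p q v) :=
    fun q hq v => dOp_eq hq (hι.contMDiff q) v
  have hinj : Function.Injective (T p) := by
    intro e e' h
    have hp := mem_extChartAt_source (I := 𝓡 n) p
    rw [← coord_symm hp e, ← coord_symm hp e', ← hpush p hp, ← hpush p hp] at h
    rw [← coord_symm hp e, ← coord_symm hp e', hι.immersion p h]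
  -- The coordinates of W q are recovered as (R T q)⁻¹ R applied to the image of W q, a smooth
  -- expression in q near p.
  obtain ⟨R, hR⟩ := exists_leftInverse_of_injective hinj
  have hu := eventually_isUnit_comp hR hT.continuousAt
  have hA : ContMDiffAt (𝓡 n)
      𝓘(ℝ, EuclideanSpace ℝ (Fin n) →L[ℝ] EuclideanSpace ℝ (Fin n)) ∞
      (fun q => R.comp (T q)) p := contMDiffAt_const.clm_comp hT
  obtain ⟨a, ha⟩ := hu.self_of_nhds
  have hinv := contDiffAt_ringInverse (n := ∞) ℝ a
  rw [ha] at hinv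
  have hw := (hinv.contMDiffAt.comp p hA).clm_apply
    ((contMDiffAt_const (c := R)).clm_apply (hW p))
  refine hw.congr_of_eventuallyEq ?_
  filter_upwards [extChartAt_source_mem_nhds (I := 𝓡 n) p, hu] with q hq huq
  have h := Ring.inverse_mul_cancel _ huq
  rw [hpush q hq]
  exact (congrArg (fun A : EuclideanSpace ℝ (Fin n) →L[ℝ] EuclideanSpace ℝ (Fin n) =>
    A (coord p q (W q))) h).symm

theorem contDiffAt_inverse_clm {X E : Type*} [NormedAddCommGroup X] [NormedSpace ℝ X]
    [NormedAddCommGroup E] [NormedSpace ℝ E] [CompleteSpace E] (J : X →L[ℝ] E →L[ℝ] E) {x : X}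
    (hx : IsUnit (J x)) : ContDiffAt ℝ ∞ (fun y => Ring.inverse (J y)) x := by
  obtain ⟨a, ha⟩ := hx
  have hinv := contDiffAt_ringInverse (n := ∞) ℝ a
  rw [ha] at hinv
  exact hinv.comp x J.contDiff.contDiffAt

theorem contDiffAt_inverse_jordan {ρ : Op H} (hρ : ρ ∈ StateSpace H) :
    ContDiffAt ℝ ∞ (fun σ : Op H => Ring.inverse (jordan σ)) ρ :=
  contDiffAt_inverse_clm (jordan (H := H)) (isUnit_jordan hρ)

omit [IsManifold (𝓡 n) ∞ M] in
theorem contMDiff_sld {ι : M → StateSpace H} (hι : IsSubmanifold n ι) {B : M → Op H}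
    (hB : ContMDiff (𝓡 n) 𝓘(ℝ, Op H) ∞ B) :
    ContMDiff (𝓡 n) 𝓘(ℝ, Op H) ∞ fun q => sld (ι q) (B q) := fun p =>
  ((contDiffAt_inverse_jordan (ι p).2).contMDiffAt.comp p (hι.contMDiff p)).clm_apply (hB p)

omit [IsManifold (𝓡 n) ∞ M] in
/-- The derivative of a function with values in a linear subspace. -/
theorem dOp_mem {Y : M → Op H} {p : M} (hY : ContMDiffAt (𝓡 n) 𝓘(ℝ, Op H) ∞ Y p)
    {K : Submodule ℝ (Op H)} (hK : ∀ q, Y q ∈ K) (v : TangentSpace (𝓡 n) p) : dOp Y p v ∈ K := by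
  -- A linear projection P onto K satisfies P ∘ Y = Y, so it also fixes the derivative of Y.
  obtain ⟨g, hg⟩ := K.subtype.exists_leftInverse_of_injective K.ker_subtype
  let P : Op H →L[ℝ] Op H := LinearMap.toContinuousLinearMap (K.subtype ∘ₗ g)
  have hP : ∀ A ∈ K, P A = A := fun A hA =>
    congrArg Subtype.val (LinearMap.congr_fun hg ⟨A, hA⟩)
  have h1 := (hY.mdifferentiableAt (by simp)).hasMFDerivAt
  have h2 := P.hasMFDerivAt.comp p h1
  have h3 : ⇑P ∘ Y = Y := funext fun q => hP _ (hK q)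
  rw [h3] at h2
  have h4 : P (dOp Y p v) = dOp Y p v :=
    congrArg (fun T : TangentSpace (𝓡 n) p →L[ℝ] Op H => T v) (hasMFDerivAt_unique h2 h1)
  rw [← h4]
  exact (g (dOp Y p v)).2

theorem dOp_jordan {A L : M → Op H} {p : M} (hA : ContMDiffAt (𝓡 n) 𝓘(ℝ, Op H) ∞ A p)
    (hL : ContMDiffAt (𝓡 n) 𝓘(ℝ, Op H) ∞ L p) (v : TangentSpace (𝓡 n) p) :
    dOp (fun q => jordan (A q) (L q)) p v =
      jordan (A p) (dOp L p v) + jordan (dOp A p v) (L p) := by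
  have hp := mem_extChartAt_source (I := 𝓡 n) p
  have hJ : ContMDiffAt (𝓡 n) 𝓘(ℝ, Op H) ∞ (fun q => jordan (A q) (L q)) p :=
    ((jordan (H := H)).contDiff.contDiffAt.contMDiffAt.comp p hA).clm_apply hL
  rw [dOp_eq hp hJ, dOp_eq hp hA, dOp_eq hp hL]
  have h1 := ((contDiffAt_comp_chart_symm le_rfl hp hA).differentiableAt (by simp)).hasFDerivAt
  have h2 := ((contDiffAt_comp_chart_symm le_rfl hp hL).differentiableAt (by simp)).hasFDerivAt
  have h3 := (jordan (H := H)).hasFDerivAt_of_bilinear h1 h2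
  have h4 : (fun q => jordan (A q) (L q)) ∘ (extChartAt (𝓡 n) p).symm = fun x =>
    jordan ((A ∘ (extChartAt (𝓡 n) p).symm) x) ((L ∘ (extChartAt (𝓡 n) p).symm) x) := rfl
  rw [h4, h3.fderiv]
  simp

omit [IsManifold (𝓡 n) ∞ M] in
theorem eConnAlong_eq_eValue {ι : M → StateSpace H} (hι : IsSubmanifold n ι) {B : M → Op H}
    (p : M) (v : TangentSpace (𝓡 n) p) (hB : B p ∈ TangentOps H) :
    eConnAlong ι p v B = eValue (ι p) (push ι p v) (B p) (dOp B p v) := by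
  rw [eConnAlong, eChristoffel_eq (ι p).2 (hι.push_mem p v) hB, eValue, eValue]
  abel

/-- The e-covariant derivative in terms of the symmetric logarithmic derivatives. -/
theorem eConnAlong_eq_jordan {ι : M → StateSpace H} (hι : IsSubmanifold n ι) {B : M → Op H}
    (hB : ContMDiff (𝓡 n) 𝓘(ℝ, Op H) ∞ B) (p : M) (v : TangentSpace (𝓡 n) p)
    (hBp : B p ∈ TangentOps H) :
    eConnAlong ι p v B = jordan (ι p : Op H)
      (dOp (fun q => sld (ι q) (B q)) p v + sldMetric (ι p) (push ι p v) (B p) • 1) := by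
  have h1 := dOp_jordan (hι.contMDiff p) (contMDiff_sld hι hB p) v
  -- The product rule on B = ρ ∘ L_B gives ∂_v B = ρ ∘ ∂_v L_B + v ∘ L_B. The last term cancels the
  -- correction in `eValue`, and the remaining multiple of ρ is absorbed through ρ = ρ ∘ 1.
  have h2 : (fun q => jordan (ι q : Op H) (sld (ι q) (B q))) = B :=
    funext fun q => jordan_sld (ι q).2 _
  rw [h2] at h1
  have h3 : jordan (ι p : Op H) 1 = ι p := by
    rw [jordan_apply, mul_one, one_mul, ← two_smul ℝ, smul_smul]
    norm_num
  rw [eConnAlong_eq_eValue hι p v hBp, eValue, h1, map_add, map_smul, h3]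
  change _ + jordan (push ι p v) _ - _ + _ = _
  abel

/-- If the spans of `1` and the symmetric logarithmic derivatives do not vary, then `M` is
e-autoparallel. -/
theorem isEAutoparallel_of_sldSpan_eq {ι : M → StateSpace H} (hι : IsSubmanifold n ι)
    (h : ∀ p q, sldSpan n ι p = sldSpan n ι q) : IsEAutoparallel n ι := by
  intro X Y hX hY
  let B : M → Op H := fun q => push ι q (Y q)
  have hB : ContMDiff (𝓡 n) 𝓘(ℝ, Op H) ∞ B := contMDiff_dOp hι.contMDiff hY
  have hA : ContMDiff (𝓡 n) 𝓘(ℝ, Op H) ∞ fun q => push ι q (X q) :=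
    contMDiff_dOp hι.contMDiff hX
  have hBt : ∀ q, B q ∈ TangentOps H := fun q => hι.push_mem q _
  have hL := contMDiff_sld hι hB
  have hW : ∀ p, ∃ w, eConnAlong ι p (X p) B = push ι p w := fun p => by
    have h1 : dOp (fun q => sld (ι q) (B q)) p (X p) ∈ sldSpan n ι p :=
      dOp_mem (hL p) (fun q => by
        rw [h p q]
        exact mem_sldSpan.2 ⟨0, Y q, by rw [zero_smul, zero_add]⟩) _
    have h2 : sldMetric (ι p) (push ι p (X p)) (B p) • (1 : Op H) ∈ sldSpan n ι p :=
      mem_sldSpan.2 ⟨_, 0, by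
        have : push ι p (0 : TangentSpace (𝓡 n) p) = 0 := map_zero (pushL ι p)
        have h0 : sld (ι p : Op H) 0 = 0 := map_zero _
        rw [this, h0, add_zero]⟩
    obtain ⟨c, w, hcw⟩ := mem_sldSpan.1 ((sldSpan n ι p).add_mem h1 h2)
    have h3 := eConnAlong_eq_jordan hι hB p (X p) (hBt p)
    have h4 : eConnAlong ι p (X p) B ∈ TangentOps H := by
      rw [eConnAlong_eq_eValue hι p _ (hBt p)]
      exact eValue_mem (ι p).2 (hι.push_mem p _) (hBt p) (dOp_mem (hB p) hBt _)
    have h5 : reTr (eConnAlong ι p (X p) B) = c := by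
      rw [h3, reTr_jordan, ← hcw, reTr_mul_sldFrame hι]
    -- The covariant derivative is ρ ∘ (c + L_w), whose trace is c; being traceless, it is the image
    -- of w.
    have h6 : c = 0 := by rw [← h5, reTr_apply, h4.2, Complex.zero_re]
    exact ⟨w, by rw [h3, ← hcw, h6, zero_smul, zero_add, jordan_sld (ι p).2]⟩
  choose W hW using hW
  refine ⟨W, isSmoothField_of_push hι ?_, hW⟩
  -- W was chosen pointwise; its image is given by an explicit formula in smooth data, which
  -- `isSmoothField_of_push` turns into smoothness of W.
  have h1 : (fun q => push ι q (W q)) = fun q => dOp B q (X q) -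
      jordan (push ι q (X q)) (sld (ι q) (B q)) +
        reTr (push ι q (X q) * sld (ι q) (B q)) • (ι q : Op H) := by
    funext q
    rw [← hW, eConnAlong_eq_eValue hι q _ (hBt q), eValue,
      sldMetric_eq (ι q).2 (hι.push_mem q _).1 (hBt q).1]
  rw [h1]
  have h2 : ContMDiff (𝓡 n) 𝓘(ℝ, Op H) ∞ fun q => jordan (push ι q (X q)) (sld (ι q) (B q)) :=
    ((jordan (H := H)).contDiff.contMDiff.comp hA).clm_apply hL
  have h3 : ContMDiff (𝓡 n) 𝓘(ℝ, ℝ) ∞ fun q => reTr (push ι q (X q) * sld (ι q) (B q)) :=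
    (reTr (H := H)).contDiff.contMDiff.comp
      (((ContinuousLinearMap.mul ℝ (Op H)).contDiff.contMDiff.comp hA).clm_apply hL)
  exact ((contMDiff_dOp hB hX).sub h2).add (h3.smul hι.contMDiff)

end SmoothFields

/-! ### Autoparallelism is equivalent to constancy of the spans -/

section Autoparallel

open Filter Topology

variable {H : Type*} [NormedAddCommGroup H] [InnerProductSpace ℂ H] [FiniteDimensional ℂ H]
variable {n : ℕ} {M : Type*} [TopologicalSpace M] [ChartedSpace (EuclideanSpace ℝ (Fin n)) M]
  [IsManifold (𝓡 n) ∞ M]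

/-- Near `p` the coordinate vector fields of a chart extend to smooth vector fields on `M`. -/
theorem exists_coordinate_fields [T2Space M] (p : M) :
    ∃ Y : EuclideanSpace ℝ (Fin n) → ∀ q : M, TangentSpace (𝓡 n) q,
      (∀ e, IsSmoothField (Y e)) ∧ ∀ᶠ q in 𝓝 p, ∀ e, coord p q (Y e q) = e := by
  -- Autoparallelism speaks of fields on all of M, so the local coordinate fields are cut off by a
  -- bump function that is 1 near p.
  obtain ⟨ψ⟩ : Nonempty (SmoothBumpFunction (𝓡 n) p) := inferInstance
  let t := trivializationAt (EuclideanSpace ℝ (Fin n)) (TangentSpace (𝓡 n) : M → Type _) p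
  refine ⟨fun e => (ψ : M → ℝ) • fun q => t.symm q e, fun e => ?_, ?_⟩
  · have hs : ContMDiffOn (𝓡 n) (𝓡 n).tangent ∞
        (fun q => (⟨q, t.symm q e⟩ : TangentBundle (𝓡 n) M)) t.baseSet := by
      refine (t.contMDiffOn_section_baseSet_iff (n := ∞) (IB := 𝓡 n)).2 ?_
      refine (contMDiffOn_const (c := e)).congr fun q hq => ?_
      rw [t.apply_mk_symm hq]
    refine ContMDiffOn.smul_section_of_tsupport (u := t.baseSet) ψ.contMDiff.contMDiffOn
      t.open_baseSet ?_ hs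
    exact ψ.tsupport_subset_chartAt_source
  · filter_upwards [extChartAt_source_mem_nhds (I := 𝓡 n) p, ψ.eventuallyEq_one] with q hq hψ e
    have h : ((ψ : M → ℝ) • fun q => t.symm q e) q = ψ q • t.symm q e := rfl
    rw [h, hψ, Pi.one_apply, one_smul]
    exact coord_symm hq e

/-- The map `sldFrame` in the chart around `p`. -/
def chartFrame (ι : M → StateSpace H) (p : M) (x : EuclideanSpace ℝ (Fin n)) :
    (ℝ × EuclideanSpace ℝ (Fin n)) →L[ℝ] Op H :=
  (ContinuousLinearMap.toSpanSingleton ℝ (1 : Op H)).coprod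
    ((Ring.inverse (jordan (ι ((extChartAt (𝓡 n) p).symm x) : Op H)) : Op H →L[ℝ] Op H).comp
      (fderiv ℝ ((fun q => (ι q : Op H)) ∘ (extChartAt (𝓡 n) p).symm) x))

theorem chartFrame_apply {ι : M → StateSpace H} (hι : IsSubmanifold n ι) {p q : M}
    (hq : q ∈ (extChartAt (𝓡 n) p).source) (c : ℝ) (v : TangentSpace (𝓡 n) q) :
    chartFrame ι p (extChartAt (𝓡 n) p q) (c, coord p q v) = sldFrame ι q (c, v) := by
  have h : (extChartAt (𝓡 n) p).symm (extChartAt (𝓡 n) p q) = q :=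
    (extChartAt (𝓡 n) p).left_inv hq
  rw [sldFrame_apply]
  change c • (1 : Op H) + sld (ι ((extChartAt (𝓡 n) p).symm (extChartAt (𝓡 n) p q)))
    (fderiv ℝ ((fun q => (ι q : Op H)) ∘ (extChartAt (𝓡 n) p).symm)
      (extChartAt (𝓡 n) p q) (coord p q v)) = _
  rw [h, push, dOp_eq hq (hι.contMDiff q)]

theorem range_chartFrame {ι : M → StateSpace H} (hι : IsSubmanifold n ι) {p q : M}
    (hq : q ∈ (extChartAt (𝓡 n) p).source) :
    Set.range (chartFrame ι p (extChartAt (𝓡 n) p q)) = sldSpan n ι q := by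
  ext F
  constructor
  · rintro ⟨⟨c, e⟩, rfl⟩
    rw [← coord_symm hq e, chartFrame_apply hι hq]
    exact ⟨_, rfl⟩
  · rintro ⟨⟨c, v⟩, rfl⟩
    exact ⟨_, chartFrame_apply hι hq c v⟩

theorem chartFrame_injective {ι : M → StateSpace H} (hι : IsSubmanifold n ι) {p q : M}
    (hq : q ∈ (extChartAt (𝓡 n) p).source) :
    Function.Injective (chartFrame ι p (extChartAt (𝓡 n) p q)) := by
  rintro ⟨c, e⟩ ⟨c', e'⟩ h
  rw [← coord_symm hq e, ← coord_symm hq e', chartFrame_apply hι hq, chartFrame_apply hι hq] at h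
  have h1 := Prod.ext_iff.1 (sldFrame_injective hι q h)
  rw [← coord_symm hq e, ← coord_symm hq e', show c = c' from h1.1]
  exact congrArg (fun v => (c', coord p q v)) h1.2

theorem differentiableAt_chartFrame {ι : M → StateSpace H} (hι : IsSubmanifold n ι) {p q : M}
    (hq : q ∈ (extChartAt (𝓡 n) p).source) :
    DifferentiableAt ℝ (chartFrame ι p) (extChartAt (𝓡 n) p q) := by
  have h0 : (extChartAt (𝓡 n) p).symm (extChartAt (𝓡 n) p q) = q :=
    (extChartAt (𝓡 n) p).left_inv hq
  have h1 := contDiffAt_comp_chart_symm le_rfl hq (hι.contMDiff q)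
  have h2 := (h1.fderiv_right (m := ∞) (by simp)).differentiableAt (by simp)
  have h3 : ContDiffAt ℝ ∞ (fun x => (Ring.inverse
      (jordan (ι ((extChartAt (𝓡 n) p).symm x) : Op H)) : Op H →L[ℝ] Op H))
      (extChartAt (𝓡 n) p q) := by
    refine ContDiffAt.comp (extChartAt (𝓡 n) p q)
      (f := (fun q => (ι q : Op H)) ∘ (extChartAt (𝓡 n) p).symm)
      (g := fun σ : Op H => Ring.inverse (jordan σ)) ?_ h1
    exact contDiffAt_inverse_jordan (ι _).2
  have h4 := (h3.differentiableAt (by simp)).clm_comp h2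
  have h5 : chartFrame ι p = fun x =>
      (ContinuousLinearMap.toSpanSingleton ℝ (1 : Op H)).comp (ContinuousLinearMap.fst ℝ ℝ _) +
      ((Ring.inverse (jordan (ι ((extChartAt (𝓡 n) p).symm x) : Op H)) : Op H →L[ℝ] Op H).comp
        (fderiv ℝ ((fun q => (ι q : Op H)) ∘ (extChartAt (𝓡 n) p).symm) x)).comp
        (ContinuousLinearMap.snd ℝ ℝ _) := by
    funext x
    ext <;> simp [chartFrame]
  rw [h5]
  exact (h4.clm_comp (differentiableAt_const _)).const_add _

/-- On an e-autoparallel submanifold the derivative of the symmetric logarithmic derivative of a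
vector field lies in the span of `1` and the symmetric logarithmic derivatives. -/
theorem dOp_sld_mem_sldSpan {ι : M → StateSpace H} (hι : IsSubmanifold n ι)
    (h : IsEAutoparallel n ι) {X Y : ∀ p : M, TangentSpace (𝓡 n) p} (hX : IsSmoothField X)
    (hY : IsSmoothField Y) (q : M) :
    dOp (fun r => sld (ι r) (push ι r (Y r))) q (X q) ∈ sldSpan n ι q := by
  obtain ⟨W, -, hW⟩ := h X Y hX hY
  have h1 := eConnAlong_eq_jordan hι (contMDiff_dOp hι.contMDiff hY) q (X q) (hι.push_mem q (Y q))
  have h2 := congrArg (sld (ι q : Op H)) (h1.symm.trans (hW q))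
  rw [sld_jordan (ι q).2] at h2
  refine mem_sldSpan.2 ⟨-sldMetric (ι q) (push ι q (X q)) (push ι q (Y q)), W q, ?_⟩
  rw [← h2, neg_smul]
  rw [add_comm, add_assoc]
  exact (congrArg _ (add_neg_cancel _)).trans (add_zero _)

/-- On an e-autoparallel submanifold the spans of `1` and the symmetric logarithmic derivatives are
locally constant. -/
theorem eventually_sldSpan_eq [T2Space M] {ι : M → StateSpace H} (hι : IsSubmanifold n ι)
    (h : IsEAutoparallel n ι) (p : M) : ∀ᶠ q in 𝓝 p, sldSpan n ι q = sldSpan n ι p := by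
  have hp := mem_extChartAt_source (I := 𝓡 n) p
  obtain ⟨Y, hY, hcoord⟩ := exists_coordinate_fields (n := n) p
  have hsrc := (isOpen_extChartAt_source (I := 𝓡 n) p).eventually_mem hp
  have key : ∀ᶠ q in 𝓝 p, ∀ e g, ∃ k,
      fderiv ℝ (chartFrame ι p) (extChartAt (𝓡 n) p q) e g =
        chartFrame ι p (extChartAt (𝓡 n) p q) k := by
    -- The fields must have constant coordinates on a neighbourhood of q, not only at q, because an
    -- identity involving them is differentiated there.
    filter_upwards [hsrc, hcoord.eventually_nhds] with q hq hcq e g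
    obtain ⟨c, e'⟩ := g
    have hd := (differentiableAt_chartFrame hι hq).hasFDerivAt
    let L : M → Op H := fun r => sld (ι r) (push ι r (Y e' r))
    have hL : ContMDiff (𝓡 n) 𝓘(ℝ, Op H) ∞ L :=
      contMDiff_sld hι (contMDiff_dOp hι.contMDiff (hY e'))
    have h1 : dOp L q (Y e q) ∈ sldSpan n ι q := dOp_sld_mem_sldSpan hι h (hY e) (hY e') q
    rw [dOp_eq hq (hL q), hcq.self_of_nhds e] at h1
    -- Up to the constant c•1, the frame applied to a fixed vector (c, e') is the logarithmic
    -- derivative of the field with coordinates e'. So its derivative is one already known to lie in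
    -- K_q.
    have h2 : L ∘ (extChartAt (𝓡 n) p).symm =ᶠ[𝓝 (extChartAt (𝓡 n) p q)]
        fun x => chartFrame ι p x (c, e') - c • 1 := by
      have hx := (extChartAt (𝓡 n) p).map_source hq
      have hcont : Tendsto (extChartAt (𝓡 n) p).symm (𝓝 (extChartAt (𝓡 n) p q)) (𝓝 q) := by
        have := continuousAt_extChartAt_symm'' (I := 𝓡 n) hx
        rwa [ContinuousAt, (extChartAt (𝓡 n) p).left_inv hq] at this
      filter_upwards [(isOpen_extChartAt_target (I := 𝓡 n) p).eventually_mem hx,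
        hcont.eventually hcq] with x hxt hxc
      have hs := (extChartAt (𝓡 n) p).map_target hxt
      have h3 := chartFrame_apply hι hs c (Y e' ((extChartAt (𝓡 n) p).symm x))
      rw [(extChartAt (𝓡 n) p).right_inv hxt, hxc e', sldFrame_apply] at h3
      rw [h3, add_sub_cancel_left]
      rfl
    have h4 : HasFDerivAt (fun x => chartFrame ι p x (c, e') - c • 1)
        ((fderiv ℝ (chartFrame ι p) (extChartAt (𝓡 n) p q)).flip (c, e'))
        (extChartAt (𝓡 n) p q) := by
      have h5 := (hd.clm_apply (hasFDerivAt_const (c, e') _)).sub_const (c • (1 : Op H))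
      refine h5.congr_fderiv ?_
      ext e
      simp
    rw [(h4.congr_of_eventuallyEq h2).fderiv] at h1
    have h6 : fderiv ℝ (chartFrame ι p) (extChartAt (𝓡 n) p q) e (c, e') ∈
        Set.range (chartFrame ι p (extChartAt (𝓡 n) p q)) := by
      rw [range_chartFrame hι hq]
      exact h1
    obtain ⟨k, hk⟩ := h6
    exact ⟨k, hk.symm⟩
  have hx := (extChartAt (𝓡 n) p).map_source hp
  have hcont : Tendsto (extChartAt (𝓡 n) p).symm (𝓝 (extChartAt (𝓡 n) p p)) (𝓝 p) := by
    have := continuousAt_extChartAt_symm'' (I := 𝓡 n) hx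
    rwa [ContinuousAt, (extChartAt (𝓡 n) p).left_inv hp] at this
  have ht := (isOpen_extChartAt_target (I := 𝓡 n) p).eventually_mem hx
  have hr := eventually_range_eq (T := chartFrame ι p) (x₀ := extChartAt (𝓡 n) p p)
    (by
      filter_upwards [ht, hcont.eventually hsrc] with x hxt hxs
      have := differentiableAt_chartFrame hι hxs
      rwa [(extChartAt (𝓡 n) p).right_inv hxt] at this)
    (chartFrame_injective hι hp)
    (by
      filter_upwards [ht, hcont.eventually key] with x hxt hk
      rwa [(extChartAt (𝓡 n) p).right_inv hxt] at hk)
  filter_upwards [hsrc, (continuousAt_extChartAt (I := 𝓡 n) p).eventually hr] with q hq hrq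
  rw [range_chartFrame hι hq, range_chartFrame hι hp] at hrq
  exact SetLike.coe_injective hrq

/-- The smooth function `p ↦ Tr (ι(p) F)` on `M`. -/
def expectationFun {ι : M → StateSpace H} (hι : IsSubmanifold n ι) :
    Op H →ₗ[ℝ] C^∞⟮𝓡 n, M; ℝ⟯ where
  toFun F := ⟨fun p => reTr ((ι p : Op H) * F),
    (expectL F).contDiff.contMDiff.comp hι.contMDiff⟩
  map_add' F G := by
    ext p
    change reTr ((ι p : Op H) * (F + G)) = reTr ((ι p : Op H) * F) + reTr ((ι p : Op H) * G)
    rw [mul_add, map_add]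
  map_smul' c F := by
    ext p
    change reTr ((ι p : Op H) * c • F) = c • reTr ((ι p : Op H) * F)
    rw [mul_smul_comm, map_smul]

omit [IsManifold (𝓡 n) ∞ M] in
/-- An operator in the span of `1` and the symmetric logarithmic derivatives at a point is
determined by its expectation function. -/
theorem eq_zero_of_expectationFun {ι : M → StateSpace H} (hι : IsSubmanifold n ι) {p : M}
    {F : Op H} (hF : F ∈ sldSpan n ι p) (h : expectationFun hι F = 0) : F = 0 := by
  obtain ⟨c, v, rfl⟩ := mem_sldSpan.1 hF
  have h0 : ∀ q, (fun _ => 0 : M → ℝ) q =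
      reTr ((ι q : Op H) * (c • 1 + sld (ι p) (push ι p v))) := fun q =>
    (DFunLike.congr_fun h q).symm
  -- The value of the zero function at p is c, and its derivative along v is g(v, v).
  have hc : 0 = c := (h0 p).trans (reTr_mul_sldFrame hι p c v)
  have h1 := mfderiv_expectation_apply hι h0 p v
  rw [reTr_push_mul_sldFrame hι, mfderiv_const] at h1
  have hv : v = 0 := push_eq_zero hι h1.symm
  rw [← hc, hv]
  exact map_zero (sldFrame (n := n) ι p)

/-- `M` is e-autoparallel if and only if the spans of `1` and the symmetric logarithmic derivatives
do not vary. -/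
theorem isEAutoparallel_iff [ConnectedSpace M] {ι : M → StateSpace H}
    (hι : IsSubmanifold n ι) :
    IsEAutoparallel n ι ↔ ∀ p q, sldSpan n ι p = sldSpan n ι q := by
  -- M inherits the Hausdorff property, needed for bump functions, from the space of operators.
  have : T2Space M := T2Space.of_injective_continuous (Subtype.val_injective.comp hι.injective)
    hι.contMDiff.continuous
  exact ⟨fun h => (IsLocallyConstant.iff_eventually_eq _).2
    (eventually_sldSpan_eq hι h) |>.apply_eq_of_preconnectedSpace,
    isEAutoparallel_of_sldSpan_eq hι⟩

end Autoparallel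

/-! ### Dimension of the space of efficiently estimable functions -/

section Dimension

variable {H : Type*} [NormedAddCommGroup H] [InnerProductSpace ℂ H] [FiniteDimensional ℂ H]
variable {n : ℕ} {M : Type*} [TopologicalSpace M] [ChartedSpace (EuclideanSpace ℝ (Fin n)) M]

/-- The functions with an efficient estimator, as a linear subspace. -/
def efficientSubmodule {ι : M → StateSpace H} (hι : IsSubmanifold n ι) :
    Submodule ℝ C^∞⟮𝓡 n, M; ℝ⟯ :=
  (⨅ p, sldSpan n ι p).map (expectationFun hι)

theorem coe_efficientSubmodule [Nonempty M] {ι : M → StateSpace H} (hι : IsSubmanifold n ι) :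
    (efficientSubmodule hι : Set C^∞⟮𝓡 n, M; ℝ⟯) = efficientFunctions ι := by
  ext f
  constructor
  · rintro ⟨F, hF, rfl⟩
    exact mem_efficientFunctions_of_mem_sldSpan hι ((Submodule.mem_iInf _).1 hF) fun _ => rfl
  · intro hf
    obtain ⟨F, hF, hfF⟩ := exists_of_mem_efficientFunctions hι hf
    exact ⟨F, (Submodule.mem_iInf _).2 hF, DFunLike.ext _ _ fun p => (hfF p).symm⟩

theorem finrank_efficientSubmodule [Nonempty M] {ι : M → StateSpace H}
    (hι : IsSubmanifold n ι) :
    Module.finrank ℝ (efficientSubmodule hι) =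
      Module.finrank ℝ (⨅ p, sldSpan n ι p : Submodule ℝ (Op H)) := by
  let Φ := (expectationFun hι).domRestrict (⨅ p, sldSpan n ι p)
  have h : Function.Injective Φ := by
    rw [← LinearMap.ker_eq_bot, LinearMap.ker_eq_bot']
    intro F hF
    exact Subtype.ext (eq_zero_of_expectationFun hι
      ((Submodule.mem_iInf _).1 F.2 (Classical.arbitrary M)) hF)
  rw [← LinearMap.finrank_range_of_inj h, efficientSubmodule, LinearMap.range_domRestrict]

/-- The intersection lies in every K_p, and each K_p has dimension n + 1; equal dimension therefore
means equality with each of them. -/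
theorem finrank_iInf_sldSpan_iff [Nonempty M] {ι : M → StateSpace H}
    (hι : IsSubmanifold n ι) :
    Module.finrank ℝ (⨅ p, sldSpan n ι p : Submodule ℝ (Op H)) = n + 1 ↔
      ∀ p q, sldSpan n ι p = sldSpan n ι q := by
  constructor
  · intro h
    have key : ∀ p, (⨅ q, sldSpan n ι q) = sldSpan n ι p := fun p =>
      Submodule.eq_of_le_of_finrank_eq (iInf_le _ p) (h.trans (finrank_sldSpan hι p).symm)
    exact fun p q => (key p).symm.trans (key q)
  · intro h
    have key : (⨅ q, sldSpan n ι q) = sldSpan n ι (Classical.arbitrary M) :=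
      (iInf_congr fun q => h q (Classical.arbitrary M)).trans iInf_const
    rw [key, finrank_sldSpan hι]

end Dimension

end QuantumInfoGeom

end

theorem mainTheorem2 {H : Type*} [NormedAddCommGroup H] [InnerProductSpace ℂ H]
    [FiniteDimensional ℂ H] {n : ℕ} {M : Type*} [TopologicalSpace M]
    [ChartedSpace (EuclideanSpace ℝ (Fin n)) M] [IsManifold (𝓡 n) ∞ M] [ConnectedSpace M]
    (ι : M → QuantumInfoGeom.StateSpace H) (hι : QuantumInfoGeom.IsSubmanifold n ι) :
    ∃ E : Submodule ℝ C^∞⟮𝓡 n, M; ℝ⟯,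
      (E : Set C^∞⟮𝓡 n, M; ℝ⟯) = QuantumInfoGeom.efficientFunctions ι ∧
        (QuantumInfoGeom.IsEAutoparallel n ι ↔ Module.finrank ℝ E = n + 1) :=
  ⟨QuantumInfoGeom.efficientSubmodule hι, QuantumInfoGeom.coe_efficientSubmodule hι, by
    rw [QuantumInfoGeom.finrank_efficientSubmodule, QuantumInfoGeom.finrank_iInf_sldSpan_iff hι,
      QuantumInfoGeom.isEAutoparallel_iff hι]⟩
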